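/- Let $p\ge q\ge 1$ be integers, $\rho\in[0,1)$, and let $P^+(q)$ be the set of real symmetric positive definite $q\times q$ matrices, with its usual topology and with the measure $\mu(\mathrm dS)=\det(S)^{-(q+1)/2}\prod_{i\le j}\mathrm dS_{ij}$. For $A,B\in P^+(q)$ write $A\circ B=B^{1/2}AB^{1/2}$, and write $A<B$ if $B-A\in P^+(q)$. Let $\mathcal L$ be the probability law on $P^+(q)$ $$\mathcal L(\mathrm d\epsilon)=(1-\rho)^{pq/2}\,\frac{\Gamma_q(p)}{\Gamma_q(p/2)^2}\;\mu(\mathrm d\epsilon)\int_{\mathcal O(p,q)}\frac{\det(\epsilon)^{p/2}}{\det\!\big(I_q+\epsilon-\rho^{1/2}(\mathsf U_1\epsilon^{1/2}+\epsilon^{1/2}\mathsf U_1^\top)\big)^{p}}\,\mathrm d\mathsf U ,$$ where $\Gamma_q$ is the multivariate Gamma function, $\mathrm d\mathsf U$ is the uniform probability distribution on $\mathcal O(p,q)=\{\mathsf U\in\mathbb R^{p\times q}:\mathsf U^\top\mathsf U=I_q\}$, and $\mathsf U_1$ consists of the first $q$ rows of $\mathsf U$. For a probability measure $\tilde\Pi(\mathrm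 dS)=\tilde\pi(S)\,\mu(\mathrm dS)$ on $P^+(q)$ with $\tilde\pi>0$, the MpCN kernel $\tilde P$ on $P^+(q)$ with parameters $\rho,p$ and target $\tilde\Pi$ is the Metropolis--Hastings kernel $$\tilde P(S,\mathrm dS')=a(S,S')\,\tilde Q(S,\mathrm dS')+\Big(1-\int a(S,S'')\,\tilde Q(S,\mathrm dS'')\Big)\delta_S(\mathrm dS'),\qquad a(S,S')=\min\{1,\tilde\pi(S')/\tilde\pi(S)\},$$ where $\tilde Q(S,\cdot)$ is the law of $\epsilon\circ S$ with $\epsilon\sim\mathcal L$. Let $U$ be a symmetric positive definite $p\times p$ matrix. The density $\tilde\pi$ is called rapidly varying if $\pi(x)=\tilde\pi(x^\top U^{-1}x)$ satisfies, for all $x,y\in\mathbb R^{p\times q}$ of rank $q$, as $\operatorname{tr}(z)\to\infty$ with $z\in P^+(q)$, $$\frac{\pi(yz)}{\pi(xz)}\longrightarrow\begin{cases}\infty,&\text{if } x^\top U^{-1}x>y^\top U^{-1}y,\\ 0,&\text{if } x^\top U^{-1}x<y^\top U^{-1}y.\end{cases}$$ Proposition. If $\tilde\pi$ is strictly positive,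 continuous and rapidly varying, then for every $\alpha\in(0,1)$ the function $\mathsf V=\tilde\pi^{-\alpha}$ satisfies $$\limsup_{\operatorname{tr}(S)\to\infty}\frac{\tilde P\mathsf V(S)-\mathsf V(S)}{\mathsf V(S)}<0 .$$ -/

import Mathlib

open MeasureTheory Filter Topology Matrix
open scoped ENNReal MatrixOrder

noncomputable section

namespace MpCN

/-! ### Matrix spaces -/

/-- The Borel σ-algebra on real matrices (it is the product σ-algebra of the entries). -/
instance instMeasurableSpaceMatrix {m n : Type*} : MeasurableSpace (Matrix m n ℝ) :=
  inferInstanceAs (MeasurableSpace (m → n → ℝ))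

instance instBorelSpaceMatrix {m n : Type*} [Fintype m] [Fintype n] :
    BorelSpace (Matrix m n ℝ) :=
  inferInstanceAs (BorelSpace (m → n → ℝ))

/-- `P⁺(q)`: the symmetric positive definite real `q × q` matrices, with the subspace topology
and its Borel σ-algebra. -/
abbrev PosDefMat (q : ℕ) : Type := {S : Matrix (Fin q) (Fin q) ℝ // S.PosDef}

/-- The filter `tr S → ∞` on `P⁺(q)`. -/
def trAtTop (q : ℕ) : Filter (PosDefMat q) :=
  Filter.comap (fun S : PosDefMat q => S.1.trace) atTop

/-- The positive definite square root `S^{1/2}`. -/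
def sqrtMat {q : ℕ} (S : PosDefMat q) : Matrix (Fin q) (Fin q) ℝ := CFC.sqrt S.1

lemma sqrtMat_mul_self {q : ℕ} (S : PosDefMat q) : sqrtMat S * sqrtMat S = S.1 :=
  CFC.sqrt_mul_sqrt_self S.1 S.2.posSemidef.nonneg

lemma posDef_sqrtMat {q : ℕ} (S : PosDefMat q) : (sqrtMat S).PosDef := by
  have h : (sqrtMat S).PosSemidef := (CFC.sqrt_nonneg S.1).posSemidef
  rw [h.posDef_iff_det_ne_zero]
  intro h0
  have h1 := congrArg Matrix.det (sqrtMat_mul_self S)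
  rw [Matrix.det_mul, h0, zero_mul] at h1
  exact S.2.det_pos.ne h1

/-- The operation `A ∘ B = B^{1/2} A B^{1/2}` on `P⁺(q)`. -/
def circ {q : ℕ} (A B : PosDefMat q) : PosDefMat q :=
  ⟨sqrtMat B * A.1 * sqrtMat B, by
    have h := posDef_sqrtMat B
    have h2 := A.2.conjTranspose_mul_mul_same (Matrix.mulVec_injective_of_isUnit h.isUnit)
    rwa [h.isHermitian.eq] at h2⟩

/-! ### Reference measures -/

/-- The entries `S_{ij}`, `i ≤ j`, as coordinates on `P⁺(q)`. -/
def upperCoords {q : ℕ} (S : PosDefMat q) : {ij : Fin q × Fin q // ij.1 ≤ ij.2} → ℝ :=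
  fun ij => S.1 ij.1.1 ij.1.2

/-- The Lebesgue measure `∏_{i ≤ j} dS_{ij}` on `P⁺(q)`. -/
def lebPos (q : ℕ) : Measure (PosDefMat q) :=
  Measure.comap upperCoords volume

/-- The invariant measure `μ(dS) = det(S)^{-(q+1)/2} ∏_{i ≤ j} dS_{ij}` on `P⁺(q)`. -/
def muPos (q : ℕ) : Measure (PosDefMat q) :=
  (lebPos q).withDensity fun S => ENNReal.ofReal (S.1.det ^ (-((q : ℝ) + 1) / 2))

/-- The symmetric matrix with prescribed entries on and above the diagonal. -/
def symOfUpper {q : ℕ} (v : {ij : Fin q × Fin q // ij.1 ≤ ij.2} → ℝ) :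
    Matrix (Fin q) (Fin q) ℝ :=
  Matrix.of fun i j => v ⟨(min i j, max i j), min_le_max⟩

/-- The coordinates `upperCoords` form a measurable embedding, so that the pull-back defining
`lebPos` is the genuine restriction of Lebesgue measure to the image of `P⁺(q)`. -/
lemma measurableEmbedding_upperCoords (q : ℕ) :
    MeasurableEmbedding (upperCoords : PosDefMat q → _) := by
  have hcs : Continuous (symOfUpper (q := q)) := by
    refine continuous_matrix fun i j => ?_
    exact continuous_apply _
  have hsym : ∀ S : PosDefMat q, symOfUpper (upperCoords S) = S.1 := by
    intro S
    ext i j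
    have hs : S.1 j i = S.1 i j := by simpa using S.2.isHermitian.apply i j
    rcases le_total i j with h | h
    · simp [symOfUpper, upperCoords, h]
    · simp [symOfUpper, upperCoords, h, hs]
  have hup : ∀ (v : {ij : Fin q × Fin q // ij.1 ≤ ij.2} → ℝ) (h : (symOfUpper v).PosDef),
      upperCoords (⟨symOfUpper v, h⟩ : PosDefMat q) = v := by
    intro v h
    ext ⟨⟨i, j⟩, hij⟩
    have hij' : i ≤ j := hij
    simp [symOfUpper, upperCoords, hij']
  have hpsd : IsClosed {v : {ij : Fin q × Fin q // ij.1 ≤ ij.2} → ℝ |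
      (symOfUpper v).PosSemidef} := by
    have heq : {v : {ij : Fin q × Fin q // ij.1 ≤ ij.2} → ℝ | (symOfUpper v).PosSemidef} =
        ⋂ x : Fin q → ℝ, {v | 0 ≤ star x ⬝ᵥ (symOfUpper v *ᵥ x)} := by
      ext v
      have hv : (symOfUpper v).IsHermitian := by
        ext i j
        simp [symOfUpper, min_comm, max_comm]
      simp only [Set.mem_ofPred_eq, Set.mem_iInter]
      rw [Matrix.posSemidef_iff_dotProduct_mulVec]
      exact and_iff_right hv
    rw [heq]
    refine isClosed_iInter fun x => isClosed_le continuous_const ?_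
    exact continuous_const.dotProduct (hcs.matrix_mulVec continuous_const)
  have hset : MeasurableSet {v : {ij : Fin q × Fin q // ij.1 ≤ ij.2} → ℝ |
      (symOfUpper v).PosDef} := by
    have heq : {v : {ij : Fin q × Fin q // ij.1 ≤ ij.2} → ℝ | (symOfUpper v).PosDef} =
        {v | (symOfUpper v).PosSemidef} ∩ {v | (symOfUpper v).det ≠ 0} := by
      ext v
      constructor
      · intro h
        exact ⟨h.posSemidef, h.det_pos.ne'⟩
      · rintro ⟨h1, h2⟩
        exact h1.posDef_iff_det_ne_zero.2 h2
    rw [heq]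
    refine hpsd.measurableSet.inter (IsOpen.measurableSet ?_)
    exact isOpen_ne_fun hcs.matrix_det continuous_const
  have hrange : Set.range (upperCoords : PosDefMat q → _) = {v | (symOfUpper v).PosDef} := by
    ext v
    constructor
    · rintro ⟨S, rfl⟩
      have h := hsym S
      simp only [Set.mem_ofPred_eq]
      rw [h]
      exact S.2
    · intro h
      exact ⟨⟨_, h⟩, hup v h⟩
  have hmeas : Measurable (upperCoords : PosDefMat q → _) := by
    refine Continuous.measurable (continuous_pi fun ij => ?_)
    exact continuous_subtype_val.matrix_elem _ _
  classical
  refine MeasurableEmbedding.of_measurable_inverse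
    (g := fun v => if h : (symOfUpper v).PosDef then ⟨symOfUpper v, h⟩ else ⟨1, PosDef.one⟩)
    hmeas (by rw [hrange]; exact hset) ?_ ?_
  · exact Measurable.dite (s := {v | (symOfUpper v).PosDef})
      (f := fun v => (⟨symOfUpper v.1, v.2⟩ : PosDefMat q)) (g := fun _ => ⟨1, PosDef.one⟩)
      (hcs.measurable.comp measurable_subtype_coe).subtype_mk measurable_const hset
  · intro S
    have h : (symOfUpper (upperCoords S)).PosDef := by rw [hsym S]; exact S.2
    simp only [h, dif_pos]
    exact Subtype.ext (hsym S)

/-! ### The uniform distribution on `𝒪(p,q)` -/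

instance instCompactSpaceOrthogonal (p : ℕ) :
    CompactSpace (Matrix.orthogonalGroup (Fin p) ℝ) := by
  have hc : IsClosed {A : Matrix (Fin p) (Fin p) ℝ | A ∈ Matrix.orthogonalGroup (Fin p) ℝ} := by
    have h : {A : Matrix (Fin p) (Fin p) ℝ | A ∈ Matrix.orthogonalGroup (Fin p) ℝ} =
        {A | A * Aᵀ = 1} := by
      ext A
      exact Matrix.mem_orthogonalGroup_iff (Fin p) ℝ
    rw [h]
    exact isClosed_eq (by fun_prop) continuous_const
  have hb : {A : Matrix (Fin p) (Fin p) ℝ | A ∈ Matrix.orthogonalGroup (Fin p) ℝ} ⊆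
      Set.pi Set.univ fun _ => Set.pi Set.univ fun _ => Set.Icc (-1 : ℝ) 1 := by
    intro A hA i _ j _
    have h1 : (A * Aᵀ) i i = 1 := by
      rw [(Matrix.mem_orthogonalGroup_iff (Fin p) ℝ).1 hA, Matrix.one_apply_eq]
    rw [Matrix.mul_apply] at h1
    have h2 : A i j * Aᵀ j i ≤ 1 := by
      rw [← h1]
      refine Finset.single_le_sum (f := fun k => A i k * Aᵀ k i) (fun k _ => ?_)
        (Finset.mem_univ j)
      simpa [Matrix.transpose_apply] using mul_self_nonneg (A i k)
    have h3 : A i j * A i j ≤ 1 := by simpa [Matrix.transpose_apply] using h2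
    exact abs_le.1 (abs_le_one_iff_mul_self_le_one.2 h3)
  have hK : IsCompact (Set.pi Set.univ fun _ : Fin p => Set.pi Set.univ fun _ : Fin p =>
      Set.Icc (-1 : ℝ) 1) :=
    isCompact_univ_pi fun _ => isCompact_univ_pi fun _ => isCompact_Icc
  exact isCompact_iff_compactSpace.1 (hK.of_isClosed_subset hc hb)

/-- The uniform (Haar) probability measure on the orthogonal group `𝒪(p)`. -/
def orthogonalHaar (p : ℕ) : Measure (Matrix.orthogonalGroup (Fin p) ℝ) :=
  Measure.haarMeasure ⊤

/-- The uniform distribution `d𝖴` on `𝒪(p,q) = {𝖴 ∈ M(p,q) : 𝖴ᵀ𝖴 = I_q}`, as a measure on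
`M(p,q)`: the law of the first `q` columns of a uniformly distributed element of `𝒪(p)`. -/
def stiefelUniform (p q : ℕ) (hqp : q ≤ p) : Measure (Matrix (Fin p) (Fin q) ℝ) :=
  (orthogonalHaar p).map fun O => O.1.submatrix id (Fin.castLE hqp)

/-! ### The law of the multiplicative noise -/

/-- The multivariate Gamma function
`Γ_q(a) = π^{q(q-1)/4} ∏_{j=1}^{q} Γ(a - (j-1)/2)`. -/
def multiGamma (q : ℕ) (a : ℝ) : ℝ :=
  Real.pi ^ ((q : ℝ) * ((q : ℝ) - 1) / 4) * ∏ j : Fin q, Real.Gamma (a - (j : ℝ) / 2)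

/-- `c_{p,q} = Γ_q(p) / Γ_q(p/2)²`. -/
def noiseConst (p q : ℕ) : ℝ :=
  multiGamma q (p : ℝ) / multiGamma q ((p : ℝ) / 2) ^ 2

/-- The law `ℒ(dε)` on `P⁺(q)`:
`(1-ρ)^{pq/2} c_{p,q} μ(dε) ∫ det(ε)^{p/2} / det(I + ε - ρ^{1/2}(𝖴₁ ε^{1/2} + ε^{1/2} 𝖴₁ᵀ))^p d𝖴`,
with `𝖴₁` the first `q` rows of `𝖴 ∈ 𝒪(p,q)`. -/
def noiseLaw (p q : ℕ) (hqp : q ≤ p) (ρ : ℝ) : Measure (PosDefMat q) :=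
  ENNReal.ofReal ((1 - ρ) ^ ((p : ℝ) * (q : ℝ) / 2) * noiseConst p q) •
    (muPos q).withDensity fun ε =>
      ∫⁻ u, ENNReal.ofReal
        (ε.1.det ^ ((p : ℝ) / 2) /
          (1 + ε.1 - Real.sqrt ρ •
            (u.submatrix (Fin.castLE hqp) id * sqrtMat ε +
              sqrtMat ε * (u.submatrix (Fin.castLE hqp) id)ᵀ)).det ^ p)
        ∂(stiefelUniform p q hqp)

/-! ### The MpCN kernel on `P⁺(q)` -/

/-- The random-walk proposal kernel `Q̃(S, ·)`: the law of `ε ∘ S` with `ε ∼ ℒ`. -/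
def mpcnProposal (p q : ℕ) (hqp : q ≤ p) (ρ : ℝ) (S : PosDefMat q) : Measure (PosDefMat q) :=
  (noiseLaw p q hqp ρ).map fun ε => circ ε S

/-- The acceptance probability `min {1, dens(y) / dens(x)}`. -/
def acceptProb {E : Type*} (dens : E → ℝ) (x y : E) : ℝ := min 1 (dens y / dens x)

/-- The Metropolis–Hastings kernel
`P(x, dy) = a(x,y) Q(x, dy) + R(x) δ_x(dy)`, `R(x) = 1 - ∫ a(x,y) Q(x, dy)`, for a proposal `Q`
reversible for a reference measure with respect to which the target has density `dens`. -/
def metropolisKernel {E : Type*} [MeasurableSpace E] (dens : E → ℝ) (Q : E → Measure E)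
    (x : E) : Measure E :=
  (Q x).withDensity (fun y => ENNReal.ofReal (acceptProb dens x y)) +
    (1 - ∫⁻ y, ENNReal.ofReal (acceptProb dens x y) ∂(Q x)) • Measure.dirac x

/-- The target `Π̃(dS) = π̃(S) μ(dS)`. -/
def targetMeasure {q : ℕ} (dens : PosDefMat q → ℝ) : Measure (PosDefMat q) :=
  (muPos q).withDensity fun S => ENNReal.ofReal (dens S)

/-- The MpCN kernel `P̃` on `P⁺(q)` with parameters `p`, `ρ` and target `π̃ dμ`. -/
def mpcnKernel (p q : ℕ) (hqp : q ≤ p) (ρ : ℝ) (dens : PosDefMat q → ℝ) :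
    PosDefMat q → Measure (PosDefMat q) :=
  metropolisKernel dens (mpcnProposal p q hqp ρ)

/-- The action `PV(x) = ∫ V(y) P(x, dy) ∈ [0, ∞]` of a kernel on a nonnegative function. -/
def kernelApply {E : Type*} [MeasurableSpace E] (P : E → Measure E) (V : E → ℝ) (x : E) : ℝ≥0∞ :=
  ∫⁻ y, ENNReal.ofReal (V y) ∂(P x)

/-! ### Rapid variation -/

/-- `h : M(p,q) → ℝ` is rapidly varying (with respect to `T ∈ P⁺(p)`): for all full-rank `x, y`,
as `tr z → ∞` in `P⁺(q)`, `h(yz)/h(xz) → ∞` if `xᵀT⁻¹x > yᵀT⁻¹y` and `h(yz)/h(xz) → 0` if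
`xᵀT⁻¹x < yᵀT⁻¹y`, in the order `A < B ↔ B - A ∈ P⁺(q)`. -/
def RapidlyVarying {p q : ℕ} (T : PosDefMat p) (h : Matrix (Fin p) (Fin q) ℝ → ℝ) : Prop :=
  ∀ x y : Matrix (Fin p) (Fin q) ℝ, x.rank = q → y.rank = q →
    ((xᵀ * T.1⁻¹ * x - yᵀ * T.1⁻¹ * y).PosDef →
      Tendsto (fun z : PosDefMat q => h (y * z.1) / h (x * z.1)) (trAtTop q) atTop) ∧
    ((yᵀ * T.1⁻¹ * y - xᵀ * T.1⁻¹ * x).PosDef →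
      Tendsto (fun z : PosDefMat q => h (y * z.1) / h (x * z.1)) (trAtTop q) (𝓝 0))

open Classical in
/-- The upcasted density `π(x) = π̃(xᵀU⁻¹x)` on `M(p,q)`; `xᵀU⁻¹x ∈ P⁺(q)` exactly when `x` has
full rank `q`, and the value at other matrices is irrelevant. -/
def upcast {p q : ℕ} (U : PosDefMat p) (dens : PosDefMat q → ℝ) (x : Matrix (Fin p) (Fin q) ℝ) :
    ℝ :=
  if h : (xᵀ * U.1⁻¹ * x).PosDef then dens ⟨xᵀ * U.1⁻¹ * x, h⟩ else 0

/-- `π̃` on `P⁺(q)` is rapidly varying when its upcast `x ↦ π̃(xᵀU⁻¹x)` to `M(p,q)` is. -/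
def RapidlyVaryingPos {p q : ℕ} (U : PosDefMat p) (dens : PosDefMat q → ℝ) : Prop :=
  RapidlyVarying U (upcast U dens)

end MpCN

end

/-!
Write `r = π̃(ε ∘ S) / π̃(S)` for the ratio attached to the noise `ε`, and `ℒ` for the noise law.
Then `P̃V(S) / V(S) = ∫ min(1, r) r^{-α} dℒ + (1 - ∫ min(1, r) dℒ)` (`kernelApply_mpcnKernel`), so
it suffices that, as `tr S → ∞`, the first integral tends to `0` and the acceptance probability
`∫ min(1, r) dℒ` stays away from `0`.

Rapid variation says that `A < B` implies `π̃(B ∘ S) / π̃(A ∘ S) → 0` (`tendsto_dens_circ_div`). For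
`ε < I` this gives `r → ∞`, so these moves are eventually accepted, and they have positive
probability; this bounds the acceptance probability from below
(`eventually_lintegral_acceptProb_gt`).

The first integrand, `g(r) = min(1, r) r^{-α} ≤ 1`, is small where `r` is close to `0` or `∞`. When
`ε - I` is indefinite, `r` need not converge. However, for `t < t'` the ratio attached to `ε + t'I`
is negligible against the one attached to `ε + tI`, and
`g(r) g(r') ≤ (r'/r)^{min(α, 1 - α)}`; hence the product of the values of `g` at two distinct points
of a line `ε + ℝI` tends to `0`. A second moment argument along these lines, combined with
translation invariance of Lebesgue measure and dominated convergence, shows that the integral tends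
to `0` (`tendsto_lintegral_of_pairwise_lines`, `tendsto_lintegral_acceptProb_mul`).

The exact normalisation of `ℒ` plays no role: only its finiteness and its positivity near `I/2` are
needed. Since `𝖴₁` is a contraction, the denominator in the density of `ℒ` lies between constant
multiples of `det(I + ε)^p`, so `ℒ` is comparable with the matrix-variate beta measure
`det(ε)^{(p-q-1)/2} det(I + ε)^{-p} dε` (`exists_noiseLaw_bounds`). The latter is finite by
induction on `q`, integrating out the first row by means of Schur complements
(`lintegral_betaDens_ne_top`).
-/

/-! ### Second moment arguments for vanishing integrals -/

lemma ENNReal.tendsto_zero_of_mul_self {X : Type*} {l : Filter X} {f : X → ℝ≥0∞}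
    (h : Tendsto (fun x => f x * f x) l (𝓝 0)) : Tendsto f l (𝓝 0) := by
  have h2 := h.ennrpow_const (1 / 2 : ℝ)
  rw [ENNReal.zero_rpow_of_pos (by norm_num)] at h2
  refine h2.congr fun x => ?_
  rw [← pow_two, ← ENNReal.rpow_natCast, ← ENNReal.rpow_mul]
  norm_num

/-- If bounded functions `g x` satisfy `g x t * g x t' → 0` for all distinct `t, t'`, then they tend
to `0` in mean against any atomless finite measure, although they need not converge at any point.
The square of the mean is a double integral of `g x t * g x t'`, and the diagonal is null. -/
lemma tendsto_lintegral_of_pairwise {X : Type*} {l : Filter X} [l.IsCountablyGenerated]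
    {T : Type*} [MeasurableSpace T] [MeasurableSingletonClass T] (τ : Measure T)
    [NullSingletonClass τ] [SFinite τ]
    (g : X → T → ℝ≥0∞) (h : T → ℝ≥0∞) (hg : ∀ x, Measurable (g x)) (hle : ∀ x t, g x t ≤ 1)
    (hh : Measurable h) (hfin : ∫⁻ t, h t ∂τ ≠ ∞)
    (hpair : ∀ t t', t ≠ t' → Tendsto (fun x => g x t * g x t') l (𝓝 0)) :
    Tendsto (fun x => ∫⁻ t, g x t * h t ∂τ) l (𝓝 0) := by
  have hlt : ∀ᵐ t ∂τ, h t < ∞ := ae_lt_top hh hfin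
  have hgh : ∀ x, Measurable fun t => g x t * h t := fun x => (hg x).mul hh
  have inner : ∀ t, Tendsto (fun x => g x t * ∫⁻ t', g x t' * h t' ∂τ) l (𝓝 0) := by
    intro t
    have : Tendsto (fun x => ∫⁻ t', g x t * (g x t' * h t') ∂τ) l (𝓝 (∫⁻ _, 0 ∂τ)) := by
      refine tendsto_lintegral_filter_of_dominated_convergence h
        (.of_forall fun x => (((hg x).mul hh).const_mul _))
        (.of_forall fun x => .of_forall fun t' => ?_) hfin ?_
      · calc g x t * (g x t' * h t') ≤ 1 * (1 * h t') := by gcongr <;> apply hle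
          _ = h t' := by simp
      · have hne : ∀ᵐ t' ∂τ, t' ≠ t := by simp [ae_iff]
        filter_upwards [hlt, hne] with t' h1 h2
        simp_rw [← mul_assoc]
        have := ENNReal.Tendsto.mul_const (hpair t t' h2.symm) (b := h t') (Or.inr h1.ne)
        simpa using this
    simp only [lintegral_zero] at this
    refine this.congr fun x => ?_
    rw [lintegral_const_mul _ (hgh x)]
  -- It suffices that the square, written as a double integral, tends to zero.
  apply ENNReal.tendsto_zero_of_mul_self
  have : Tendsto (fun x => ∫⁻ t, (g x t * ∫⁻ t', g x t' * h t' ∂τ) * h t ∂τ) l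
      (𝓝 (∫⁻ _, 0 ∂τ)) := by
    refine tendsto_lintegral_filter_of_dominated_convergence
      (fun t => (∫⁻ t', h t' ∂τ) * h t)
      (.of_forall fun x => (((hg x).mul_const _).mul hh))
      (.of_forall fun x => .of_forall fun t => ?_) ?_ ?_
    · gcongr
      calc g x t * ∫⁻ t', g x t' * h t' ∂τ ≤ 1 * ∫⁻ t', 1 * h t' ∂τ := by
            gcongr <;> apply hle
        _ = _ := by simp
    · rw [lintegral_const_mul _ hh]
      exact ENNReal.mul_ne_top hfin hfin
    · filter_upwards [hlt] with t h1
      have := ENNReal.Tendsto.mul_const (inner t) (b := h t) (Or.inr h1.ne)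
      simpa using this
  simp only [lintegral_zero] at this
  refine this.congr fun x => ?_
  rw [← lintegral_mul_const _ (hgh x)]
  refine lintegral_congr fun t => ?_
  ring

/-- The several-variable form of `tendsto_lintegral_of_pairwise`: the products are only required to
vanish along the lines of one fixed direction `w`. Translation invariance of `m` allows to average
over the translates by `t • w`, `t ∈ [0, 1]`, which reduces the claim to one line at a time. -/
lemma tendsto_lintegral_of_pairwise_lines {X : Type*} {l : Filter X} [l.IsCountablyGenerated]
    {E : Type*} [NormedAddCommGroup E] [NormedSpace ℝ E] [MeasurableSpace E] [BorelSpace E]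
    [SecondCountableTopology E] (m : Measure E) [SFinite m] [m.IsAddRightInvariant] (w : E)
    (g : X → E → ℝ≥0∞) (h : E → ℝ≥0∞) (hg : ∀ x, Measurable (g x)) (hle : ∀ x v, g x v ≤ 1)
    (hh : Measurable h) (hfin : ∫⁻ v, h v ∂m ≠ ∞)
    (hpair : ∀ v (t t' : ℝ), t < t' →
      Tendsto (fun x => g x (v + t • w) * g x (v + t' • w)) l (𝓝 0)) :
    Tendsto (fun x => ∫⁻ v, g x v * h v ∂m) l (𝓝 0) := by
  set τ : Measure ℝ := volume.restrict (Set.Icc 0 1) with hτ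
  have hτ1 : τ Set.univ = 1 := by simp [hτ]
  have hmap : Measurable fun z : E × ℝ => z.1 + z.2 • w := by fun_prop
  have key : ∀ f : E → ℝ≥0∞, Measurable f →
      ∫⁻ v, f v ∂m = ∫⁻ v, ∫⁻ t, f (v + t • w) ∂τ ∂m := by
    intro f hf
    rw [lintegral_lintegral_swap (f := fun v t => f (v + t • w)) (hf.comp hmap).aemeasurable]
    have : ∀ t : ℝ, ∫⁻ v, f (v + t • w) ∂m = ∫⁻ v, f v ∂m := fun t =>
      lintegral_add_right_eq_self f (t • w)
    simp [this, hτ1]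
  have hH := key h hh
  have hHm : Measurable fun v => ∫⁻ t, h (v + t • w) ∂τ := (hh.comp hmap).lintegral_prod_right'
  have : Tendsto (fun x => ∫⁻ v, ∫⁻ t, g x (v + t • w) * h (v + t • w) ∂τ ∂m) l
      (𝓝 (∫⁻ _, 0 ∂m)) := by
    refine tendsto_lintegral_filter_of_dominated_convergence (fun v => ∫⁻ t, h (v + t • w) ∂τ)
      (.of_forall fun x => ?_) (.of_forall fun x => .of_forall fun v => ?_) (by rwa [← hH]) ?_
    · exact ((((hg x).mul hh)).comp hmap).lintegral_prod_right'
    · refine lintegral_mono fun t => ?_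
      calc g x (v + t • w) * h (v + t • w) ≤ 1 * h (v + t • w) := by gcongr; apply hle
        _ = _ := one_mul _
    · filter_upwards [ae_lt_top hHm (by rwa [← hH])] with v hv
      have hmv : Measurable fun t : ℝ => v + t • w := by fun_prop
      refine tendsto_lintegral_of_pairwise τ (fun x t => g x (v + t • w))
        (fun t => h (v + t • w)) (fun x => (hg x).comp hmv) (fun x t => hle _ _)
        (hh.comp hmv) hv.ne fun t t' htt => ?_
      rcases htt.lt_or_gt with h1 | h1
      · exact hpair v t t' h1
      · simpa only [mul_comm] using hpair v t' t h1
  simp only [lintegral_zero] at this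
  refine this.congr fun x => ?_
  exact (key _ ((hg x).mul hh)).symm

/-! ### Trace and determinant inequalities -/

namespace Matrix

lemma PosSemidef.sq_apply_le {n : Type*} [Fintype n] {A : Matrix n n ℝ}
    (hA : A.PosSemidef) (i j : n) : A i j ^ 2 ≤ A i i * A j j := by
  have h := (hA.submatrix ![i, j]).det_nonneg
  have hs : A j i = A i j := by simpa using hA.isHermitian.apply i j
  rw [det_fin_two] at h
  simp [hs] at h
  nlinarith

lemma PosSemidef.trace_mul_self_le {n : Type*} [Fintype n] {A : Matrix n n ℝ}
    (hA : A.PosSemidef) : (A * A).trace ≤ A.trace ^ 2 := by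
  have hs : ∀ i j, A j i = A i j := fun i j => by simpa using hA.isHermitian.apply i j
  simp only [trace, diag_apply, mul_apply, pow_two, Finset.sum_mul_sum]
  refine Finset.sum_le_sum fun i _ => Finset.sum_le_sum fun j _ => ?_
  rw [hs i j, ← pow_two]
  exact hA.sq_apply_le i j

lemma PosSemidef.one_le_det_one_add {n : Type*} [Fintype n] [DecidableEq n] {A : Matrix n n ℝ}
    (hA : A.PosSemidef) : 1 ≤ (1 + A).det := by
  have h1 : (1 + A).IsHermitian := isHermitian_one.add hA.isHermitian
  rw [h1.det_eq_prod_eigenvalues]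
  have : ∀ i, 1 ≤ h1.eigenvalues i := by
    intro i
    have h2 := h1.eigenvalues_eq i
    have h3 := hA.dotProduct_mulVec_nonneg (x := (h1.eigenvectorBasis i).ofLp)
    have h4 : star (h1.eigenvectorBasis i).ofLp ⬝ᵥ (h1.eigenvectorBasis i).ofLp = 1 := by
      have h5 := h1.eigenvectorBasis.orthonormal.1 i
      have h6 := EuclideanSpace.real_norm_sq_eq (h1.eigenvectorBasis i)
      rw [h5] at h6
      simp only [dotProduct, star_trivial, ← pow_two]
      linarith
    rw [add_mulVec, dotProduct_add, one_mulVec, h4] at h2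
    simp only [RCLike.re_to_real] at h2
    linarith
  simpa using Finset.prod_le_prod (s := Finset.univ) (fun _ _ => zero_le_one) fun i _ => this i

/-- The determinant is monotone for the Loewner order. -/
lemma PosDef.det_le_det {n : Type*} [Fintype n] [DecidableEq n] {A B : Matrix n n ℝ}
    (hA : A.PosDef) (hAB : (B - A).PosSemidef) : A.det ≤ B.det := by
  obtain ⟨R, hR, hR2⟩ : ∃ R : Matrix n n ℝ, R.IsHermitian ∧ R * R = A :=
    ⟨CFC.sqrt A, (CFC.sqrt_nonneg A).posSemidef.isHermitian,
      CFC.sqrt_mul_sqrt_self A hA.posSemidef.nonneg⟩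
  have hdet : R.det * R.det = A.det := by rw [← det_mul, hR2]
  have hu : IsUnit R.det := by
    rw [isUnit_iff_ne_zero]
    intro h0
    rw [h0, zero_mul] at hdet
    exact hA.det_pos.ne hdet
  have h1 := hAB.mul_mul_conjTranspose_same R⁻¹
  rw [conjTranspose_nonsing_inv, hR.eq] at h1
  have h2 : R * (1 + R⁻¹ * (B - A) * R⁻¹) * R = B := by
    rw [mul_add, add_mul, mul_one, hR2]
    have : R * (R⁻¹ * (B - A) * R⁻¹) * R = (R * R⁻¹) * (B - A) * (R⁻¹ * R) := by
      simp only [Matrix.mul_assoc]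
    rw [this, mul_nonsing_inv _ hu, nonsing_inv_mul _ hu]
    simp
  have h3 := h1.one_le_det_one_add
  rw [← h2, det_mul, det_mul]
  have := hA.det_pos
  nlinarith

end Matrix

/-! ### Rapid variation on positive definite matrices -/

namespace MpCN

lemma tendsto_sqrtMat_trAtTop (q : ℕ) :
    Tendsto (fun S : PosDefMat q => (⟨sqrtMat S, posDef_sqrtMat S⟩ : PosDefMat q))
      (trAtTop q) (trAtTop q) := by
  rw [trAtTop, tendsto_comap_iff]
  have h : Tendsto (fun S : PosDefMat q => Real.sqrt S.1.trace) (trAtTop q) atTop :=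
    Real.tendsto_sqrt_atTop.comp tendsto_comap
  refine tendsto_atTop_mono (fun S => ?_) h
  have h1 := (posDef_sqrtMat S).posSemidef.trace_mul_self_le
  rw [sqrtMat_mul_self] at h1
  exact Real.sqrt_le_iff.2 ⟨(posDef_sqrtMat S).posSemidef.trace_nonneg, h1⟩

/-- Every `A ∈ P⁺(q)` is of the form `xᵀU⁻¹x`, with `x = U^{1/2} (I_q, 0)ᵀ A^{1/2}`. -/
lemma exists_transpose_mul_inv_mul {p q : ℕ} (hqp : q ≤ p) (U : PosDefMat p) (A : PosDefMat q) :
    ∃ x : Matrix (Fin p) (Fin q) ℝ, x.rank = q ∧ xᵀ * U.1⁻¹ * x = A.1 := by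
  set J : Matrix (Fin p) (Fin q) ℝ := (1 : Matrix (Fin p) (Fin p) ℝ).submatrix id (Fin.castLE hqp)
  have hJ : Jᵀ * J = 1 := by
    ext i j
    simp [J, mul_apply, one_apply]
  have hUs : (sqrtMat U)ᵀ = sqrtMat U := by
    simpa using (posDef_sqrtMat U).isHermitian.eq
  have hAs : (sqrtMat A)ᵀ = sqrtMat A := by
    simpa using (posDef_sqrtMat A).isHermitian.eq
  have hu : IsUnit (sqrtMat U).det := (posDef_sqrtMat U).det_pos.ne'.isUnit
  have hinv : sqrtMat U * U.1⁻¹ * sqrtMat U = 1 := by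
    conv_lhs => rw [← sqrtMat_mul_self U]
    rw [Matrix.mul_inv_rev, ← Matrix.mul_assoc, mul_nonsing_inv _ hu, one_mul, nonsing_inv_mul _ hu]
  have hx : (sqrtMat U * J * sqrtMat A)ᵀ * U.1⁻¹ * (sqrtMat U * J * sqrtMat A) = A.1 := by
    calc _ = sqrtMat A * (Jᵀ * (sqrtMat U * U.1⁻¹ * sqrtMat U) * J) * sqrtMat A := by
          simp only [transpose_mul, hUs, hAs, Matrix.mul_assoc]
      _ = A.1 := by rw [hinv, Matrix.mul_one, hJ, Matrix.mul_one, sqrtMat_mul_self]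
  refine ⟨_, le_antisymm ((rank_le_width _)) ?_, hx⟩
  have h1 : A.1.rank = q := by
    simpa using rank_of_isUnit A.1 A.2.isUnit
  calc q = A.1.rank := h1.symm
    _ ≤ _ := by rw [← hx]; exact rank_mul_le_right _ _

/-- Rapid variation in intrinsic form: if `A < B` then `π̃(B ∘ S) / π̃(A ∘ S) → 0`. The matrix `z`
of the definition is taken to be `S^{1/2}`, whose trace tends to infinity with that of `S`. -/
lemma tendsto_dens_circ_div {p q : ℕ} (hqp : q ≤ p) {U : PosDefMat p} {dens : PosDefMat q → ℝ}
    (hrapid : RapidlyVaryingPos U dens) {A B : PosDefMat q} (hAB : (B.1 - A.1).PosDef) :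
    Tendsto (fun S => dens (circ B S) / dens (circ A S)) (trAtTop q) (𝓝 0) := by
  obtain ⟨x, hx, hxA⟩ := exists_transpose_mul_inv_mul hqp U A
  obtain ⟨y, hy, hyB⟩ := exists_transpose_mul_inv_mul hqp U B
  have h1 := ((hrapid x y hx hy).2 (by rwa [hxA, hyB])).comp (tendsto_sqrtMat_trAtTop q)
  refine h1.congr fun S => ?_
  have key : ∀ (w : Matrix (Fin p) (Fin q) ℝ) (C : PosDefMat q), wᵀ * U.1⁻¹ * w = C.1 →
      upcast U dens (w * sqrtMat S) = dens (circ C S) := by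
    intro w C hw
    have hSs : (sqrtMat S)ᵀ = sqrtMat S := by
      simpa using (posDef_sqrtMat S).isHermitian.eq
    have h2 : (w * sqrtMat S)ᵀ * U.1⁻¹ * (w * sqrtMat S) = (circ C S).1 := by
      simp only [circ, transpose_mul, hSs, ← hw, Matrix.mul_assoc]
    have h3 : ((w * sqrtMat S)ᵀ * U.1⁻¹ * (w * sqrtMat S)).PosDef := h2 ▸ (circ C S).2
    rw [upcast, dif_pos h3]
    congr 1
    exact Subtype.ext h2
  simp only [Function.comp_apply]
  rw [key x A hxA, key y B hyB]

lemma circ_one {q : ℕ} (S : PosDefMat q) : circ ⟨1, PosDef.one⟩ S = S :=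
  Subtype.ext (by simp [circ, sqrtMat_mul_self])

/-- The ratio `π̃(ε ∘ S) / π̃(S)` of the target density at the proposal and at the current state. -/
noncomputable def densRatio {q : ℕ} (dens : PosDefMat q → ℝ) (S ε : PosDefMat q) : ℝ :=
  dens (circ ε S) / dens S

lemma continuous_circ_left {q : ℕ} (S : PosDefMat q) : Continuous fun ε => circ ε S := by
  refine Continuous.subtype_mk ?_ _
  fun_prop

end MpCN

lemma min_one_mul_rpow_le {α r : ℝ} (hr : 0 < r) (hα : α ∈ Set.Ioo (0 : ℝ) 1) :
    min 1 r * r ^ (-α) ≤ 1 := by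
  obtain ⟨h0, h1⟩ := hα
  rcases le_total 1 r with h | h
  · rw [min_eq_left h, one_mul]
    exact Real.rpow_le_one_of_one_le_of_nonpos h (by linarith)
  · rw [min_eq_right h]
    have : r * r ^ (-α) = r ^ (1 - α) := by
      rw [sub_eq_add_neg, Real.rpow_add hr, Real.rpow_one]
    rw [this]
    exact Real.rpow_le_one hr.le h (by linarith)

/-- For `c = min α (1 - α)` the function `g r = min 1 r * r ^ (-α)` is at most `r ^ (-c)` and at
most `r ^ c`; the first bound at `r` and the second at `r'` give the claim. -/
lemma min_one_mul_rpow_mul_le {α r r' : ℝ} (hr : 0 < r) (hr' : 0 < r')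
    (hα : α ∈ Set.Ioo (0 : ℝ) 1) :
    (min 1 r * r ^ (-α)) * (min 1 r' * r' ^ (-α)) ≤ (r' / r) ^ min α (1 - α) := by
  have hb := min_one_mul_rpow_le hr hα
  have hb' := min_one_mul_rpow_le hr' hα
  obtain ⟨h0, h1⟩ := hα
  set c := min α (1 - α) with hc
  have hc0 : 0 < c := lt_min h0 (by linarith)
  have hcα : c ≤ α := min_le_left _ _
  have hcα' : c ≤ 1 - α := min_le_right _ _
  have e1 : min 1 r * r ^ (-α) ≤ r ^ (-c) := by
    rcases le_total 1 r with h | h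
    · rw [min_eq_left h, one_mul]
      exact Real.rpow_le_rpow_of_exponent_le h (by linarith)
    · exact hb.trans (Real.one_le_rpow_of_pos_of_le_one_of_nonpos hr h (by linarith))
  have e2 : min 1 r' * r' ^ (-α) ≤ r' ^ c := by
    rcases le_total 1 r' with h | h
    · exact hb'.trans (Real.one_le_rpow h hc0.le)
    · rw [min_eq_right h]
      have : r' * r' ^ (-α) = r' ^ (1 - α) := by
        rw [sub_eq_add_neg, Real.rpow_add hr', Real.rpow_one]
      rw [this]
      exact Real.rpow_le_rpow_of_exponent_ge hr' h hcα'
  calc _ ≤ r ^ (-c) * r' ^ c := by gcongr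
    _ = _ := by
      rw [Real.div_rpow hr'.le hr.le, Real.rpow_neg hr.le]
      field_simp

/-! ### Upper-triangular coordinates -/

namespace MpCN

/-- The index set of the entries on and above the diagonal. -/
abbrev UpperIdx (q : ℕ) : Type := {ij : Fin q × Fin q // ij.1 ≤ ij.2}

lemma isHermitian_symOfUpper {q : ℕ} (v : UpperIdx q → ℝ) : (symOfUpper v).IsHermitian := by
  ext i j
  simp [symOfUpper, min_comm, max_comm]

lemma symOfUpper_upperCoords {q : ℕ} (S : PosDefMat q) : symOfUpper (upperCoords S) = S.1 := by
  ext i j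
  have hs : S.1 j i = S.1 i j := by simpa using S.2.isHermitian.apply i j
  rcases le_total i j with h | h
  · simp [symOfUpper, upperCoords, h]
  · simp [symOfUpper, upperCoords, h, hs]

lemma upperCoords_symOfUpper {q : ℕ} (v : UpperIdx q → ℝ) (h : (symOfUpper v).PosDef) :
    upperCoords (⟨symOfUpper v, h⟩ : PosDefMat q) = v := by
  ext ⟨⟨i, j⟩, hij⟩
  have hij' : i ≤ j := hij
  simp [symOfUpper, upperCoords, hij']

lemma range_upperCoords (q : ℕ) :
    Set.range (upperCoords : PosDefMat q → _) = {v | (symOfUpper v).PosDef} := by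
  ext v
  constructor
  · rintro ⟨S, rfl⟩
    rw [Set.mem_ofPred_eq, symOfUpper_upperCoords]
    exact S.2
  · intro h
    exact ⟨⟨_, h⟩, upperCoords_symOfUpper v h⟩

lemma measurableSet_posDef_symOfUpper (q : ℕ) :
    MeasurableSet {v : UpperIdx q → ℝ | (symOfUpper v).PosDef} :=
  range_upperCoords q ▸ (measurableEmbedding_upperCoords q).measurableSet_range

lemma continuous_symOfUpper (q : ℕ) : Continuous (symOfUpper (q := q)) :=
  continuous_matrix fun _ _ => continuous_apply _

lemma lintegral_lebPos {q : ℕ} (f : (UpperIdx q → ℝ) → ℝ≥0∞) :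
    ∫⁻ S, f (upperCoords S) ∂lebPos q = ∫⁻ v in {v | (symOfUpper v).PosDef}, f v := by
  rw [← range_upperCoords, lebPos, ← (measurableEmbedding_upperCoords q).map_comap,
    (measurableEmbedding_upperCoords q).lintegral_map]

/-- The upper-triangular entries of a matrix of size `q + 1`: the corner entry, the rest of the
first row, and the upper-triangular entries of the lower right `q × q` block. -/
noncomputable def upperIdxEquiv (q : ℕ) : Unit ⊕ (Fin q ⊕ UpperIdx q) ≃ UpperIdx (q + 1) :=
  Equiv.ofBijective
    (Sum.elim (fun _ => ⟨(0, 0), le_rfl⟩) (Sum.elim (fun i => ⟨(0, i.succ), Fin.zero_le _⟩)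
      fun ij => ⟨(ij.1.1.succ, ij.1.2.succ), Fin.succ_le_succ_iff.2 ij.2⟩)) <| by
    constructor
    · rintro (_ | i | ⟨⟨i, j⟩, hij⟩) (_ | i' | ⟨⟨i', j'⟩, hij'⟩) h <;>
        simp_all [Fin.succ_ne_zero, (Fin.succ_ne_zero _).symm]
    · rintro ⟨⟨i, j⟩, hij⟩
      induction i using Fin.cases with
      | zero =>
        induction j using Fin.cases with
        | zero => exact ⟨Sum.inl (), rfl⟩
        | succ j => exact ⟨Sum.inr (Sum.inl j), rfl⟩
      | succ i =>
        induction j using Fin.cases with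
        | zero => exact absurd hij (by simp)
        | succ j => exact ⟨Sum.inr (Sum.inr ⟨(i, j), Fin.succ_le_succ_iff.1 hij⟩), rfl⟩

/-- The coordinates of the symmetric matrix with corner entry `a`, remaining first row `b` and lower
right block with coordinates `w`. -/
noncomputable def borderCoords {q : ℕ} (a : ℝ) (b : Fin q → ℝ) (w : UpperIdx q → ℝ) :
    UpperIdx (q + 1) → ℝ :=
  fun ij => Sum.elim (fun _ => a) (Sum.elim b w) ((upperIdxEquiv q).symm ij)

lemma symOfUpper_borderCoords {q : ℕ} (a : ℝ) (b : Fin q → ℝ) (w : UpperIdx q → ℝ) :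
    (symOfUpper (borderCoords a b w)).submatrix (Sum.elim Fin.succ fun _ : Unit => 0)
      (Sum.elim Fin.succ fun _ : Unit => 0) =
    fromBlocks (symOfUpper w) (of fun i _ => b i) (of fun _ j => b j) (of fun _ _ => a) := by
  have h0 : (upperIdxEquiv q).symm ⟨(0, 0), le_rfl⟩ = Sum.inl () :=
    (Equiv.symm_apply_eq _).2 rfl
  have h1 : ∀ i : Fin q, (upperIdxEquiv q).symm ⟨(0, i.succ), Fin.zero_le _⟩ =
      Sum.inr (Sum.inl i) := fun i => (Equiv.symm_apply_eq _).2 rfl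
  have h2 : ∀ i j : Fin q, ∀ h : i ≤ j,
      (upperIdxEquiv q).symm ⟨(i.succ, j.succ), Fin.succ_le_succ_iff.2 h⟩ =
      Sum.inr (Sum.inr ⟨(i, j), h⟩) := fun i j h => (Equiv.symm_apply_eq _).2 rfl
  ext (i | i) (j | j)
  · rcases le_total i j with h | h
    · simp [symOfUpper, borderCoords, Fin.succ_le_succ_iff.2 h, h, h2 i j h]
    · simp [symOfUpper, borderCoords, Fin.succ_le_succ_iff.2 h, h, h2 j i h]
  · simp [symOfUpper, borderCoords, h1]
  · simp [symOfUpper, borderCoords, h1]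
  · simp [symOfUpper, borderCoords, h0]

lemma lintegral_borderCoords {q : ℕ} (f : (UpperIdx (q + 1) → ℝ) → ℝ≥0∞) (hf : Measurable f) :
    ∫⁻ v, f v = ∫⁻ w, ∫⁻ b, ∫⁻ a : ℝ, f (borderCoords a b w) := by
  have e1 := volume_measurePreserving_piCongrLeft (fun _ => ℝ) (upperIdxEquiv q)
  have e2 := volume_measurePreserving_sumPiEquivProdPi_symm
    (fun _ : Unit ⊕ (Fin q ⊕ UpperIdx q) => ℝ)
  have e3 := volume_measurePreserving_sumPiEquivProdPi_symm
    (fun _ : Fin q ⊕ UpperIdx q => ℝ)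
  have e4 := (volume_preserving_funUnique Unit ℝ).symm
  have e5 := e1.comp (e2.comp (e4.prod e3))
  have e6 : MeasurePreserving
      (fun z : ℝ × ((Fin q → ℝ) × (UpperIdx q → ℝ)) => borderCoords z.1 z.2.1 z.2.2) := by
    convert! e5 using 1
    ext z ij
    obtain ⟨x, rfl⟩ := (upperIdxEquiv q).surjective ij
    simp only [Function.comp_apply]
    rw [MeasurableEquiv.coe_piCongrLeft, Equiv.piCongrLeft_apply_apply]
    rcases x with x | x | x <;> simp [borderCoords] <;> rfl
  have hm := hf.comp e6.measurable
  rw [← e6.lintegral_comp hf]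
  refine (lintegral_prod_symm _ hm.aemeasurable).trans ?_
  exact lintegral_prod_symm _ (hm.lintegral_prod_left').aemeasurable

end MpCN

/-! ### Finiteness of the matrix-variate beta integral -/

lemma lintegral_rpow_mul_one_add_rpow_ne_top {k c : ℝ} (hk : -1 < k) (hc : k + 1 < c) :
    ∫⁻ s in Set.Ioi (0 : ℝ), ENNReal.ofReal (s ^ k * (1 + s) ^ (-c)) ≠ ∞ := by
  rw [← Set.Ioc_union_Ioi_eq_Ioi zero_le_one,
    lintegral_union measurableSet_Ioi (Set.Ioc_disjoint_Ioi le_rfl)]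
  refine ENNReal.add_ne_top.2 ⟨
    ne_top_of_le_ne_top (b := ∫⁻ s in Set.Ioc (0 : ℝ) 1, ENNReal.ofReal (s ^ k)) ?_ ?_,
    ne_top_of_le_ne_top (b := ∫⁻ s in Set.Ioi (1 : ℝ), ENNReal.ofReal (s ^ (k - c))) ?_ ?_⟩
  · have h := (intervalIntegral.intervalIntegrable_rpow' hk (a := 0) (b := 1)).1
    exact (h.lintegral_lt_top).ne
  · refine setLIntegral_mono' measurableSet_Ioc fun s hs => ENNReal.ofReal_le_ofReal ?_
    have h1 : (1 + s) ^ (-c) ≤ 1 :=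
      Real.rpow_le_one_of_one_le_of_nonpos (by linarith [hs.1]) (by linarith)
    have := Real.rpow_nonneg hs.1.le k
    nlinarith
  · exact (integrableOn_Ioi_rpow_of_lt (by linarith) one_pos).lintegral_lt_top.ne
  · refine setLIntegral_mono' measurableSet_Ioi fun s hs => ENNReal.ofReal_le_ofReal ?_
    have hs0 : (0 : ℝ) < s := one_pos.trans hs
    rw [sub_eq_add_neg, Real.rpow_add hs0]
    gcongr ?_ * ?_
    exact Real.rpow_le_rpow_of_nonpos hs0 (by linarith) (by linarith)

/-- The substitution `y = M^{1/2} b`; the inequality comes from using the supremum norm of `y`. -/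
lemma lintegral_one_add_dotProduct_mulVec_le {q : ℕ} {M : Matrix (Fin q) (Fin q) ℝ}
    (hM : M.PosDef) {c : ℝ} (hc : 0 ≤ c) :
    ∫⁻ b : Fin q → ℝ, ENNReal.ofReal ((1 + b ⬝ᵥ M *ᵥ b) ^ (-c)) ≤
      ENNReal.ofReal (M.det ^ (-(1 / 2) : ℝ)) *
        ∫⁻ y : Fin q → ℝ, ENNReal.ofReal ((1 + ‖y‖ ^ 2) ^ (-c)) := by
  set N := MpCN.sqrtMat (⟨M, hM⟩ : MpCN.PosDefMat q) with hN
  have hNN : N * N = M := MpCN.sqrtMat_mul_self _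
  have hNp : N.PosDef := MpCN.posDef_sqrtMat _
  have hNt : Nᵀ = N := by simpa using hNp.isHermitian.eq
  have hdet : N.det = M.det ^ (1 / 2 : ℝ) := by
    rw [← hNN, det_mul, ← pow_two, ← Real.rpow_natCast, ← Real.rpow_mul hNp.det_pos.le]
    norm_num
  have hmap := Real.map_matrix_volume_pi_eq_smul_volume_pi hNp.det_pos.ne'
  have hmeas : Measurable fun y : Fin q → ℝ => ENNReal.ofReal ((1 + ‖y‖ ^ 2) ^ (-c)) := by
    fun_prop
  have h1 : ∫⁻ b : Fin q → ℝ, ENNReal.ofReal ((1 + ‖N *ᵥ b‖ ^ 2) ^ (-c)) =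
      ENNReal.ofReal (M.det ^ (-(1 / 2) : ℝ)) *
        ∫⁻ y : Fin q → ℝ, ENNReal.ofReal ((1 + ‖y‖ ^ 2) ^ (-c)) := by
    have hl : Measurable fun b : Fin q → ℝ => toLin' N b :=
      (LinearMap.continuous_of_finiteDimensional _).measurable
    have := lintegral_map (μ := volume) hmeas hl
    simp only [toLin'_apply] at this
    have hmap' : Measure.map (fun b => N *ᵥ b) volume = ENNReal.ofReal |N.det⁻¹| • volume := hmap
    rw [← this, hmap', lintegral_smul_measure, smul_eq_mul]
    congr 2
    rw [abs_of_pos (inv_pos.2 hNp.det_pos), hdet, ← Real.rpow_neg hM.det_pos.le]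
  rw [← h1]
  refine lintegral_mono fun b => ENNReal.ofReal_le_ofReal ?_
  refine Real.rpow_le_rpow_of_nonpos (by positivity) ?_ (by linarith)
  have h2 : b ⬝ᵥ M *ᵥ b = (N *ᵥ b) ⬝ᵥ (N *ᵥ b) := by
    rw [← hNN, ← mulVec_mulVec, dotProduct_mulVec, ← mulVec_transpose, hNt]
  rw [h2]
  gcongr
  set y := N *ᵥ b
  have h3 : ‖y‖ ≤ Real.sqrt (y ⬝ᵥ y) := by
    refine (pi_norm_le_iff_of_nonneg (Real.sqrt_nonneg _)).2 fun i => ?_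
    rw [Real.norm_eq_abs]
    refine Real.abs_le_sqrt ?_
    rw [pow_two]
    exact Finset.single_le_sum (f := fun i => y i * y i) (fun i _ => mul_self_nonneg _)
      (Finset.mem_univ i)
  have h4 : 0 ≤ y ⬝ᵥ y := Finset.sum_nonneg fun i _ => mul_self_nonneg _
  calc ‖y‖ ^ 2 ≤ Real.sqrt (y ⬝ᵥ y) ^ 2 := by gcongr
    _ = _ := Real.sq_sqrt h4

lemma lintegral_one_add_norm_sq_rpow_ne_top {q : ℕ} {c : ℝ} (hc : (q : ℝ) < 2 * c) :
    ∫⁻ y : Fin q → ℝ, ENNReal.ofReal ((1 + ‖y‖ ^ 2) ^ (-c)) ≠ ∞ := by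
  have h := integrable_rpow_neg_one_add_norm_sq (E := Fin q → ℝ) (μ := volume) (r := 2 * c)
    (by simpa using hc)
  have h2 : -(2 * c) / 2 = -c := by ring
  rw [h2] at h
  exact h.lintegral_lt_top.ne

namespace MpCN

/-- The unnormalised matrix-variate beta (type II) density `det(S)^k det(I + S)^{-c}`, in
upper-triangular coordinates and extended by zero off the positive definite matrices. -/
noncomputable def betaDens (q : ℕ) (k c : ℝ) (v : UpperIdx q → ℝ) : ℝ≥0∞ :=
  {v | (symOfUpper v).PosDef}.indicator
    (fun v => ENNReal.ofReal ((symOfUpper v).det ^ k * (1 + symOfUpper v).det ^ (-c))) v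

lemma measurable_betaDens (q : ℕ) (k c : ℝ) : Measurable (betaDens q k c) := by
  have h := continuous_symOfUpper q
  refine Measurable.indicator ?_ (measurableSet_posDef_symOfUpper q)
  have h1 : Measurable fun v : UpperIdx q → ℝ => (symOfUpper v).det := h.matrix_det.measurable
  have h2 : Measurable fun v : UpperIdx q → ℝ => (1 + symOfUpper v).det :=
    (continuous_const.add h).matrix_det.measurable
  fun_prop

lemma posDef_borderCoords {q : ℕ} {a : ℝ} {b : Fin q → ℝ} {w : UpperIdx q → ℝ}
    (h : (symOfUpper (borderCoords a b w)).PosDef) : (symOfUpper w).PosDef := by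
  have h1 := h.submatrix (e := Fin.succ) (Fin.succ_injective q)
  have h2 := congrArg (fun A => A.submatrix Sum.inl Sum.inl) (symOfUpper_borderCoords a b w)
  simp only [submatrix_submatrix] at h2
  convert! h1 using 1
  exact h2.symm

/-- The Schur complement formula for `det(tI + S)`; it is used for `t = 0` and `t = 1`. -/
lemma det_add_symOfUpper_borderCoords {q : ℕ} (a : ℝ) (b : Fin q → ℝ) (w : UpperIdx q → ℝ)
    (t : ℝ) (h : (t • (1 : Matrix (Fin q) (Fin q) ℝ) + symOfUpper w).det ≠ 0) :
    (t • (1 : Matrix (Fin (q + 1)) (Fin (q + 1)) ℝ) + symOfUpper (borderCoords a b w)).det =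
      (t • (1 : Matrix (Fin q) (Fin q) ℝ) + symOfUpper w).det *
        (t + a - b ⬝ᵥ (t • (1 : Matrix (Fin q) (Fin q) ℝ) + symOfUpper w)⁻¹ *ᵥ b) := by
  let e : Fin q ⊕ Unit ≃ Fin (q + 1) :=
    (Equiv.optionEquivSumPUnit _).symm.trans (finSuccEquiv q).symm
  have he : (e : Fin q ⊕ Unit → Fin (q + 1)) = Sum.elim Fin.succ fun _ => 0 := by
    ext (i | i) <;> simp [e]
  have h1 := symOfUpper_borderCoords a b w
  rw [← he] at h1
  set D := t • (1 : Matrix (Fin q) (Fin q) ℝ) + symOfUpper w with hD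
  have h2 : (t • (1 : Matrix (Fin (q + 1)) (Fin (q + 1)) ℝ) +
      symOfUpper (borderCoords a b w)).submatrix e e =
      fromBlocks D (of fun i _ => b i) (of fun _ j => b j) (of fun _ _ => t + a) := by
    have : (t • (1 : Matrix (Fin (q + 1)) (Fin (q + 1)) ℝ)).submatrix e e =
        fromBlocks (t • 1) 0 0 (of fun _ _ => t) := by
      ext (i | i) (j | j) <;> simp [one_apply]
    change (t • (1 : Matrix (Fin (q + 1)) (Fin (q + 1)) ℝ)).submatrix e e +
      (symOfUpper (borderCoords a b w)).submatrix e e = _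
    rw [this, h1, fromBlocks_add]
    simp only [zero_add]
    rfl
  have : Invertible D := invertibleOfIsUnitDet _ h.isUnit
  rw [← det_submatrix_equiv_self e, h2, det_fromBlocks₁₁, det_unique (n := Unit)]
  congr 1
  simp only [Matrix.sub_apply, of_apply, invOf_eq_nonsing_inv]
  congr 1
  simp [mul_apply, dotProduct, mulVec, Finset.sum_mul, Finset.mul_sum, mul_assoc]
  rw [Finset.sum_comm]
lemma inv_sub_inv_one_add {n : Type*} [Fintype n] [DecidableEq n] {D : Matrix n n ℝ}
    (hD : D.PosDef) : D⁻¹ - (1 + D)⁻¹ = (D + D * D)⁻¹ := by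
  have h1 : (1 + D).PosDef := PosDef.one.add hD
  rw [Matrix.inv_sub_inv (by simp [hD.isUnit, h1.isUnit]), add_sub_cancel_right, Matrix.mul_one,
    ← Matrix.mul_inv_rev]
  congr 1
  noncomm_ring

lemma posDef_add_mul_self {n : Type*} [Fintype n] [DecidableEq n] {D : Matrix n n ℝ}
    (hD : D.PosDef) : (D + D * D).PosDef := by
  refine hD.add_posSemidef ?_
  have := posSemidef_conjTranspose_mul_self D
  rwa [hD.isHermitian.eq] at this

/-- With `D` the lower right block, `s = a - bᵀD⁻¹b` and `M = D⁻¹ - (I + D)⁻¹ = (D + D²)⁻¹`, the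
Schur complements of `S` and `I + S` are `s` and `1 + bᵀMb + s`, and the latter dominates both
`1 + bᵀMb` and `1 + s`. This separates the variables `s` and `b`. -/
lemma betaDens_borderCoords_le {q : ℕ} {k c₁ c₂ : ℝ} (h₁ : 0 ≤ c₁) (h₂ : 0 ≤ c₂) (a : ℝ)
    (b : Fin q → ℝ) (w : UpperIdx q → ℝ) :
    betaDens (q + 1) k (c₁ + c₂) (borderCoords a b w) ≤ betaDens q k (c₁ + c₂) w *
      (ENNReal.ofReal ((1 + b ⬝ᵥ (symOfUpper w + symOfUpper w * symOfUpper w)⁻¹ *ᵥ b) ^ (-c₁)) *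
      (Set.Ioi 0).indicator (fun s : ℝ => ENNReal.ofReal (s ^ k * (1 + s) ^ (-c₂)))
        (a - b ⬝ᵥ (symOfUpper w)⁻¹ *ᵥ b)) := by
  by_cases hp : (symOfUpper (borderCoords a b w)).PosDef
  swap
  · rw [betaDens, Set.indicator_of_notMem (by exact hp)]
    exact zero_le
  have hD := posDef_borderCoords hp
  have h1D : (1 + symOfUpper w).PosDef := PosDef.one.add hD
  have e0 := det_add_symOfUpper_borderCoords a b w 0 (by simpa using hD.det_pos.ne')
  have e1 := det_add_symOfUpper_borderCoords a b w 1 (by simpa using h1D.det_pos.ne')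
  simp only [zero_smul, zero_add, one_smul] at e0 e1
  rw [betaDens, Set.indicator_of_mem (by exact hp), betaDens, Set.indicator_of_mem (by exact hD),
    e0, e1]
  set D := symOfUpper w
  set s := a - b ⬝ᵥ D⁻¹ *ᵥ b with hs
  have hs0 : 0 < s := by
    have := hp.det_pos
    rw [e0] at this
    exact pos_of_mul_pos_right this hD.det_pos.le
  set m := b ⬝ᵥ (D + D * D)⁻¹ *ᵥ b with hm
  have hm0 : 0 ≤ m := by
    simpa using (posDef_add_mul_self hD).inv.posSemidef.dotProduct_mulVec_nonneg b
  have e2 : 1 + a - b ⬝ᵥ (1 + D)⁻¹ *ᵥ b = 1 + m + s := by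
    rw [hm, hs, ← inv_sub_inv_one_add hD, sub_mulVec, dotProduct_sub]
    ring
  rw [e2, Set.indicator_of_mem (by exact hs0), ← ENNReal.ofReal_mul (by positivity),
    ← ENNReal.ofReal_mul (by have := hD.det_pos; have := h1D.det_pos; positivity)]
  refine ENNReal.ofReal_le_ofReal ?_
  have hd := hD.det_pos
  have hd1 := h1D.det_pos
  rw [Real.mul_rpow hd.le hs0.le, Real.mul_rpow hd1.le (by positivity)]
  have e3 : (1 + m + s) ^ (-(c₁ + c₂)) ≤ (1 + m) ^ (-c₁) * (1 + s) ^ (-c₂) := by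
    rw [neg_add, Real.rpow_add (by positivity)]
    gcongr ?_ * ?_
    · exact Real.rpow_le_rpow_of_nonpos (by positivity) (by linarith) (by linarith)
    · exact Real.rpow_le_rpow_of_nonpos (by positivity) (by linarith) (by linarith)
  calc _ = (D.det ^ k * (1 + D).det ^ (-(c₁ + c₂)) * s ^ k) * (1 + m + s) ^ (-(c₁ + c₂)) := by
        ring
    _ ≤ (D.det ^ k * (1 + D).det ^ (-(c₁ + c₂)) * s ^ k) *
        ((1 + m) ^ (-c₁) * (1 + s) ^ (-c₂)) := by gcongr
    _ = _ := by ring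

/-- The Jacobian `det(M)^{-1/2} = det(D)^{1/2} det(I + D)^{1/2}` of the substitution in `b` turns a
beta density into another one. -/
lemma betaDens_mul_det_rpow {q : ℕ} (k c : ℝ) (w : UpperIdx q → ℝ) :
    betaDens q k c w *
      ENNReal.ofReal (((symOfUpper w + symOfUpper w * symOfUpper w)⁻¹).det ^ (-(1 / 2) : ℝ)) =
    betaDens q (k + 1 / 2) (c - 1 / 2) w := by
  by_cases hp : (symOfUpper w).PosDef
  swap
  · rw [betaDens, betaDens, Set.indicator_of_notMem (by exact hp),
      Set.indicator_of_notMem (by exact hp), zero_mul]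
  have h1 : (1 + symOfUpper w).PosDef := PosDef.one.add hp
  rw [betaDens, betaDens, Set.indicator_of_mem (by exact hp), Set.indicator_of_mem (by exact hp)]
  set D := symOfUpper w
  have hd := hp.det_pos
  have hd1 := h1.det_pos
  rw [← ENNReal.ofReal_mul (by positivity)]
  congr 1
  have e : D + D * D = D * (1 + D) := by noncomm_ring
  rw [e, det_nonsing_inv, Ring.inverse_eq_inv', det_mul, Real.inv_rpow (by positivity),
    ← Real.rpow_neg (by positivity), neg_neg, Real.mul_rpow hd.le hd1.le, Real.rpow_add hd,
    neg_sub, sub_eq_neg_add, Real.rpow_add hd1]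
  ring

/-- The matrix-variate beta integral is finite. By induction on the size: integrating out the first
row changes the exponents `(k, c)` to `(k + 1/2, c - 1/2)`. -/
theorem lintegral_betaDens_ne_top (q : ℕ) (k c : ℝ) (hk : -1 < k) (hc : q < c - k) :
    ∫⁻ v, betaDens q k c v ≠ ∞ := by
  induction q generalizing k c with
  | zero =>
    have : ∀ v, betaDens 0 k c v ≤ 1 := by
      intro v
      refine Set.indicator_le_self' (fun _ _ => zero_le) v |>.trans ?_
      simp
    refine ne_top_of_le_ne_top (b := ∫⁻ _, 1) ?_ (lintegral_mono this)
    simp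
  | succ q ih =>
    push_cast at hc
    -- The exponent `c` is shared out so that both the integral over `b ∈ ℝ^q` (which needs
    -- `q < 2 c₁`) and the one over `s > 0` (which needs `k + 1 < c₂`) converge.
    obtain ⟨c₁, hc₁⟩ : ∃ c₁, c₁ = (c - k - 1) / 2 := ⟨_, rfl⟩
    obtain ⟨c₂, hc₂⟩ : ∃ c₂, c₂ = c - c₁ := ⟨_, rfl⟩
    have hcc : c = c₁ + c₂ := by linarith
    have hq : (0 : ℝ) ≤ q := Nat.cast_nonneg q
    have h₁ : (q : ℝ) < 2 * c₁ := by linarith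
    have h₂ : k + 1 < c₂ := by linarith
    have hJ := lintegral_rpow_mul_one_add_rpow_ne_top hk h₂
    have hK := lintegral_one_add_norm_sq_rpow_ne_top h₁
    rw [lintegral_borderCoords _ (measurable_betaDens _ _ _)]
    refine ne_top_of_le_ne_top (b := ∫⁻ w, betaDens q (k + 1 / 2) (c - 1 / 2) w *
      ((∫⁻ y : Fin q → ℝ, ENNReal.ofReal ((1 + ‖y‖ ^ 2) ^ (-c₁))) *
        ∫⁻ s in Set.Ioi (0 : ℝ), ENNReal.ofReal (s ^ k * (1 + s) ^ (-c₂)))) ?_ ?_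
    · rw [lintegral_mul_const _ (measurable_betaDens _ _ _)]
      exact ENNReal.mul_ne_top (ih _ _ (by linarith) (by linarith)) (ENNReal.mul_ne_top hK hJ)
    · refine lintegral_mono fun w => ?_
      by_cases hp : (symOfUpper w).PosDef
      swap
      · have h0 : ∀ a b, betaDens (q + 1) k c (borderCoords a b w) = 0 := by
          intro a b
          rw [betaDens, Set.indicator_of_notMem]
          exact fun h => hp (posDef_borderCoords h)
        simp [h0]
      have hmJ : Measurable ((Set.Ioi 0).indicator
          fun s : ℝ => ENNReal.ofReal (s ^ k * (1 + s) ^ (-c₂))) :=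
        Measurable.indicator (by fun_prop) measurableSet_Ioi
      rw [← betaDens_mul_det_rpow, hcc]
      set M := (symOfUpper w + symOfUpper w * symOfUpper w)⁻¹ with hM
      have hMp : M.PosDef := (posDef_add_mul_self hp).inv
      set J := ∫⁻ s in Set.Ioi (0 : ℝ), ENNReal.ofReal (s ^ k * (1 + s) ^ (-c₂)) with hJdef
      have hin : ∀ b : Fin q → ℝ,
          ∫⁻ a, betaDens (q + 1) k (c₁ + c₂) (borderCoords a b w) ≤
            betaDens q k (c₁ + c₂) w * J * ENNReal.ofReal ((1 + b ⬝ᵥ M *ᵥ b) ^ (-c₁)) := by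
        intro b
        refine (lintegral_mono fun a =>
          betaDens_borderCoords_le (by linarith) (by linarith) a b w).trans ?_
        have hm2 : Measurable fun a : ℝ => (Set.Ioi 0).indicator
            (fun s : ℝ => ENNReal.ofReal (s ^ k * (1 + s) ^ (-c₂)))
            (a - b ⬝ᵥ (symOfUpper w)⁻¹ *ᵥ b) := hmJ.comp (measurable_id.sub_const _)
        rw [lintegral_const_mul _ (hm2.const_mul _), lintegral_const_mul _ hm2,
          lintegral_sub_right_eq_self, lintegral_indicator measurableSet_Ioi]
        exact le_of_eq (by ring)
      refine (lintegral_mono hin).trans ?_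
      rw [lintegral_const_mul' _ _ (ENNReal.mul_ne_top ?_ hJ)]
      · calc _ ≤ betaDens q k (c₁ + c₂) w * J * (ENNReal.ofReal (M.det ^ (-(1 / 2) : ℝ)) *
            ∫⁻ y : Fin q → ℝ, ENNReal.ofReal ((1 + ‖y‖ ^ 2) ^ (-c₁))) := by
              gcongr
              exact lintegral_one_add_dotProduct_mulVec_le hMp (by linarith)
          _ = _ := by ring
      · rw [betaDens, Set.indicator_of_mem (by exact hp)]
        exact ENNReal.ofReal_ne_top

end MpCN

/-! ### Two-sided bounds for the noise law -/

namespace MpCN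

/-- A square block of an orthogonal matrix is a contraction. -/
lemma posSemidef_one_sub_orthogonal_block {p q : ℕ} (hqp : q ≤ p)
    (O : Matrix.orthogonalGroup (Fin p) ℝ) :
    (1 - O.1.submatrix (Fin.castLE hqp) (Fin.castLE hqp) *
      (O.1.submatrix (Fin.castLE hqp) (Fin.castLE hqp))ᵀ).PosSemidef := by
  set J : Matrix (Fin p) (Fin q) ℝ := (1 : Matrix (Fin p) (Fin p) ℝ).submatrix id (Fin.castLE hqp)
    with hJdef
  have hJ : Jᵀ * J = 1 := by
    ext i j
    simp [J, mul_apply, one_apply]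
  have hO : O.1 * O.1ᵀ = 1 := (mem_orthogonalGroup_iff (Fin p) ℝ).1 O.2
  have hU : O.1.submatrix (Fin.castLE hqp) (Fin.castLE hqp) = Jᵀ * O.1 * J := by
    ext i j
    simp [J, mul_apply, one_apply]
  have hE : (1 - J * Jᵀ)ᴴ * (1 - J * Jᵀ) = 1 - J * Jᵀ := by
    have h1 : (1 - J * Jᵀ)ᴴ = 1 - J * Jᵀ := by simp
    have h2 : J * Jᵀ * (J * Jᵀ) = J * Jᵀ := by
      calc _ = J * (Jᵀ * J) * Jᵀ := by simp only [Matrix.mul_assoc]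
        _ = _ := by rw [hJ, Matrix.mul_one]
    rw [h1, Matrix.mul_sub, Matrix.mul_one, Matrix.sub_mul, Matrix.one_mul, h2, sub_self, sub_zero]
  have h3 := (hE ▸ posSemidef_conjTranspose_mul_self (1 - J * Jᵀ)).mul_mul_conjTranspose_same
    (Jᵀ * O.1)
  convert! h3 using 1
  rw [hU, Matrix.mul_sub, Matrix.sub_mul, Matrix.mul_one]
  simp only [conjTranspose_eq_transpose_of_trivial, transpose_mul, transpose_transpose]
  congr 1
  · calc _ = Jᵀ * (O.1 * O.1ᵀ) * J := by rw [hO, Matrix.mul_one, hJ]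
      _ = _ := by simp only [Matrix.mul_assoc]
  · simp only [Matrix.mul_assoc]

/-- The matrix is `(I - WWᵀ) + (Wᵀ - ε^{1/2})ᵀ(Wᵀ - ε^{1/2})`. -/
lemma posSemidef_one_add_sub_of_contraction {q : ℕ} (ε : PosDefMat q)
    {W : Matrix (Fin q) (Fin q) ℝ} (hW : (1 - W * Wᵀ).PosSemidef) :
    (1 + ε.1 - (W * sqrtMat ε + sqrtMat ε * Wᵀ)).PosSemidef := by
  have hs : (sqrtMat ε)ᵀ = sqrtMat ε := by simpa using (posDef_sqrtMat ε).isHermitian.eq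
  have h := hW.add (posSemidef_conjTranspose_mul_self (Wᵀ - sqrtMat ε))
  convert! h using 1
  simp only [conjTranspose_eq_transpose_of_trivial, transpose_sub, transpose_transpose, hs, sub_mul,
    mul_sub, sqrtMat_mul_self]
  abel

/-- The matrix in the denominator of the noise density lies between `(1 - r)(I + ε)` and
`(1 + r)(I + ε)` in the Loewner order. -/
lemma noiseDenom_bounds {q : ℕ} (ε : PosDefMat q) {W : Matrix (Fin q) (Fin q) ℝ}
    (hW : (1 - W * Wᵀ).PosSemidef) {r : ℝ} (hr0 : 0 ≤ r) (hr1 : r < 1) :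
    (1 - r) ^ q * (1 + ε.1).det ≤ (1 + ε.1 - r • (W * sqrtMat ε + sqrtMat ε * Wᵀ)).det ∧
    (1 + ε.1 - r • (W * sqrtMat ε + sqrtMat ε * Wᵀ)).det ≤ (1 + r) ^ q * (1 + ε.1).det := by
  have h1 : (1 + ε.1).PosDef := PosDef.one.add ε.2
  have ha := (posSemidef_one_add_sub_of_contraction ε hW).smul hr0
  have hb := (posSemidef_one_add_sub_of_contraction ε (W := -W) (by simpa using hW)).smul hr0
  have hlow : ((1 - r) • (1 + ε.1)).PosDef := h1.smul (by linarith)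
  have hd : ∀ t : ℝ, (t • (1 + ε.1)).det = t ^ q * (1 + ε.1).det := fun t => by
    rw [det_smul, Fintype.card_fin]
  have hmid : (1 + ε.1 - r • (W * sqrtMat ε + sqrtMat ε * Wᵀ)).PosDef := by
    convert! hlow.add_posSemidef ha using 1
    module
  constructor
  · rw [← hd]
    refine hlow.det_le_det ?_
    convert! ha using 1
    module
  · rw [← hd]
    refine hmid.det_le_det ?_
    convert! hb using 1
    simp only [transpose_neg, neg_mul, mul_neg]
    module

instance isProbabilityMeasure_orthogonalHaar (p : ℕ) :
    IsProbabilityMeasure (orthogonalHaar p) :=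
  ⟨Measure.haarMeasure_self (K₀ := ⊤)⟩

lemma continuous_firstColumns {p q : ℕ} (hqp : q ≤ p) :
    Continuous fun O : Matrix.orthogonalGroup (Fin p) ℝ => O.1.submatrix id (Fin.castLE hqp) :=
  continuous_subtype_val.matrix_submatrix _ _

instance isProbabilityMeasure_stiefelUniform {p q : ℕ} (hqp : q ≤ p) :
    IsProbabilityMeasure (stiefelUniform p q hqp) :=
  Measure.isProbabilityMeasure_map (continuous_firstColumns hqp).measurable.aemeasurable

lemma ae_stiefelUniform_contraction {p q : ℕ} (hqp : q ≤ p) :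
    ∀ᵐ u ∂stiefelUniform p q hqp,
      (1 - u.submatrix (Fin.castLE hqp) id * (u.submatrix (Fin.castLE hqp) id)ᵀ).PosSemidef := by
  have hcl : IsClosed {u : Matrix (Fin p) (Fin q) ℝ |
      (1 - u.submatrix (Fin.castLE hqp) id * (u.submatrix (Fin.castLE hqp) id)ᵀ).PosSemidef} := by
    have heq : {u : Matrix (Fin p) (Fin q) ℝ |
        (1 - u.submatrix (Fin.castLE hqp) id * (u.submatrix (Fin.castLE hqp) id)ᵀ).PosSemidef} =
        ⋂ x : Fin q → ℝ, {u | 0 ≤ star x ⬝ᵥ ((1 - u.submatrix (Fin.castLE hqp) id *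
          (u.submatrix (Fin.castLE hqp) id)ᵀ) *ᵥ x)} := by
      ext u
      simp only [Set.mem_ofPred_eq, Set.mem_iInter]
      rw [posSemidef_iff_dotProduct_mulVec]
      refine and_iff_right (isHermitian_one.sub ?_)
      simpa using isHermitian_mul_conjTranspose_self (u.submatrix (Fin.castLE hqp) id)
    rw [heq]
    refine isClosed_iInter fun x => isClosed_le continuous_const ?_
    have hc : Continuous fun u : Matrix (Fin p) (Fin q) ℝ => u.submatrix (Fin.castLE hqp) id :=
      continuous_id.matrix_submatrix _ _
    exact continuous_const.dotProduct
      ((continuous_const.sub (hc.matrix_mul hc.matrix_transpose)).matrix_mulVec continuous_const)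
  rw [stiefelUniform, ae_map_iff (continuous_firstColumns hqp).measurable.aemeasurable
    hcl.measurableSet]
  exact .of_forall fun O => posSemidef_one_sub_orthogonal_block hqp O

/-- The density of `noiseLaw` with respect to `muPos`, up to the normalising constant. -/
noncomputable def noiseDens (p q : ℕ) (hqp : q ≤ p) (ρ : ℝ) (ε : PosDefMat q) : ℝ≥0∞ :=
  ∫⁻ u, ENNReal.ofReal
    (ε.1.det ^ ((p : ℝ) / 2) /
      (1 + ε.1 - Real.sqrt ρ •
        (u.submatrix (Fin.castLE hqp) id * sqrtMat ε +
          sqrtMat ε * (u.submatrix (Fin.castLE hqp) id)ᵀ)).det ^ p)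
    ∂(stiefelUniform p q hqp)

lemma noiseDens_bounds {p q : ℕ} (hqp : q ≤ p) {ρ : ℝ} (hρ1 : ρ < 1) (ε : PosDefMat q) :
    ENNReal.ofReal ((((1 + Real.sqrt ρ) ^ q) ^ p)⁻¹ *
        (ε.1.det ^ ((p : ℝ) / 2) * (1 + ε.1).det ^ (-(p : ℝ)))) ≤ noiseDens p q hqp ρ ε ∧
    noiseDens p q hqp ρ ε ≤ ENNReal.ofReal ((((1 - Real.sqrt ρ) ^ q) ^ p)⁻¹ *
        (ε.1.det ^ ((p : ℝ) / 2) * (1 + ε.1).det ^ (-(p : ℝ)))) := by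
  have hr1 : Real.sqrt ρ < 1 := by rw [Real.sqrt_lt' one_pos]; simpa using hρ1
  have hr0 := Real.sqrt_nonneg ρ
  have hd : 0 < ε.1.det := ε.2.det_pos
  have hd1 : 0 < (1 + ε.1).det := (PosDef.one.add ε.2).det_pos
  have hm : 0 < 1 - Real.sqrt ρ := by linarith
  have hK : ∀ t : ℝ, 0 < t → (t ^ p)⁻¹ * (ε.1.det ^ ((p : ℝ) / 2) * (1 + ε.1).det ^ (-(p : ℝ))) =
      ε.1.det ^ ((p : ℝ) / 2) / (t * (1 + ε.1).det) ^ p := by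
    intro t ht
    rw [Real.rpow_neg hd1.le, Real.rpow_natCast, mul_pow]
    field_simp
  rw [hK _ (by positivity), hK _ (by positivity)]
  constructor
  · calc _ = ∫⁻ _, ENNReal.ofReal (ε.1.det ^ ((p : ℝ) / 2) /
          ((1 + Real.sqrt ρ) ^ q * (1 + ε.1).det) ^ p) ∂(stiefelUniform p q hqp) := by simp
      _ ≤ _ := by
        refine lintegral_mono_ae ?_
        filter_upwards [ae_stiefelUniform_contraction hqp] with u hu
        obtain ⟨h1, h2⟩ := noiseDenom_bounds ε hu hr0 hr1
        have h3 := lt_of_lt_of_le (by positivity) h1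
        gcongr
  · calc noiseDens p q hqp ρ ε ≤ ∫⁻ _, ENNReal.ofReal (ε.1.det ^ ((p : ℝ) / 2) /
          ((1 - Real.sqrt ρ) ^ q * (1 + ε.1).det) ^ p) ∂(stiefelUniform p q hqp) := by
          refine lintegral_mono_ae ?_
          filter_upwards [ae_stiefelUniform_contraction hqp] with u hu
          obtain ⟨h1, h2⟩ := noiseDenom_bounds ε hu hr0 hr1
          gcongr
      _ = _ := by simp

lemma multiGamma_pos {q : ℕ} {a : ℝ} (ha : (q : ℝ) ≤ 2 * a) : 0 < multiGamma q a := by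
  refine mul_pos (Real.rpow_pos_of_pos Real.pi_pos _) (Finset.prod_pos fun j _ => ?_)
  refine Real.Gamma_pos_of_pos ?_
  have : (j : ℝ) < q := by exact_mod_cast j.2
  linarith

lemma noiseConst_pos {p q : ℕ} (hqp : q ≤ p) : 0 < noiseConst p q := by
  have : (q : ℝ) ≤ p := by exact_mod_cast hqp
  have hp : (0 : ℝ) ≤ p := p.cast_nonneg
  exact div_pos (multiGamma_pos (by linarith)) (pow_pos (multiGamma_pos (by linarith)) 2)

lemma lintegral_muPos_withDensity {p q : ℕ} {K : ℝ} (hK : 0 ≤ K)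
    {f : (UpperIdx q → ℝ) → ℝ≥0∞} (hf : Measurable f) :
    ∫⁻ ε, f (upperCoords ε) ∂(muPos q).withDensity (fun ε => ENNReal.ofReal (K *
        (ε.1.det ^ ((p : ℝ) / 2) * (1 + ε.1).det ^ (-(p : ℝ))))) =
      ENNReal.ofReal K * ∫⁻ v, f v * betaDens q (((p : ℝ) - q - 1) / 2) p v := by
  have hdet : Measurable fun ε : PosDefMat q => ε.1.det :=
    continuous_subtype_val.matrix_det.measurable
  have hdet1 : Measurable fun ε : PosDefMat q => (1 + ε.1).det :=
    (continuous_const.add continuous_subtype_val).matrix_det.measurable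
  have hfu : Measurable fun ε : PosDefMat q => f (upperCoords ε) :=
    hf.comp (measurableEmbedding_upperCoords q).measurable
  rw [lintegral_withDensity_eq_lintegral_mul _ (by fun_prop) hfu, muPos,
    lintegral_withDensity_eq_lintegral_mul _ (by fun_prop)
      ((by fun_prop : Measurable fun ε : PosDefMat q => ENNReal.ofReal (K *
        (ε.1.det ^ ((p : ℝ) / 2) * (1 + ε.1).det ^ (-(p : ℝ))))).mul hfu)]
  have h1 : ∀ ε : PosDefMat q,
      ENNReal.ofReal K * (f (upperCoords ε) *
        betaDens q (((p : ℝ) - q - 1) / 2) p (upperCoords ε)) =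
      ENNReal.ofReal (ε.1.det ^ (-((q : ℝ) + 1) / 2)) * (ENNReal.ofReal (K *
        (ε.1.det ^ ((p : ℝ) / 2) * (1 + ε.1).det ^ (-(p : ℝ)))) * f (upperCoords ε)) := by
    intro ε
    have hd : 0 < ε.1.det := ε.2.det_pos
    rw [betaDens, Set.indicator_of_mem (by
      rw [Set.mem_ofPred_eq, symOfUpper_upperCoords]; exact ε.2), symOfUpper_upperCoords,
      ENNReal.ofReal_mul hK]
    have h2 : ε.1.det ^ (((p : ℝ) - q - 1) / 2) * (1 + ε.1).det ^ (-(p : ℝ)) =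
        ε.1.det ^ (-((q : ℝ) + 1) / 2) *
          (ε.1.det ^ ((p : ℝ) / 2) * (1 + ε.1).det ^ (-(p : ℝ))) := by
      rw [← mul_assoc, ← Real.rpow_add hd]
      congr 2
      ring
    rw [h2, ENNReal.ofReal_mul (by positivity)]
    ring
  simp only [Pi.mul_apply]
  simp_rw [← h1]
  rw [lintegral_const_mul', lintegral_lebPos (fun v => f v * betaDens q _ p v)]
  · congr 1
    rw [← lintegral_indicator (measurableSet_posDef_symOfUpper q)]
    refine lintegral_congr fun v => ?_
    by_cases hv : (symOfUpper v).PosDef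
    · rw [Set.indicator_of_mem (by exact hv)]
    · rw [Set.indicator_of_notMem (by exact hv), betaDens, Set.indicator_of_notMem (by exact hv),
        mul_zero]
  · exact ENNReal.ofReal_ne_top

/-- The noise law is comparable, from both sides, with the matrix-variate beta measure. -/
theorem exists_noiseLaw_bounds {p q : ℕ} (hqp : q ≤ p) {ρ : ℝ} (hρ1 : ρ < 1) :
    ∃ c C : ℝ≥0∞, c ≠ 0 ∧ C ≠ ∞ ∧ ∀ f : (UpperIdx q → ℝ) → ℝ≥0∞, Measurable f →
      c * ∫⁻ v, f v * betaDens q (((p : ℝ) - q - 1) / 2) p v ≤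
        ∫⁻ ε, f (upperCoords ε) ∂noiseLaw p q hqp ρ ∧
      ∫⁻ ε, f (upperCoords ε) ∂noiseLaw p q hqp ρ ≤
        C * ∫⁻ v, f v * betaDens q (((p : ℝ) - q - 1) / 2) p v := by
  have hr1 : Real.sqrt ρ < 1 := by rw [Real.sqrt_lt' one_pos]; simpa using hρ1
  have hr0 := Real.sqrt_nonneg ρ
  have hm : 0 < 1 - Real.sqrt ρ := by linarith
  set A := ENNReal.ofReal ((1 - ρ) ^ ((p : ℝ) * (q : ℝ) / 2) * noiseConst p q) with hA
  have hA0 : A ≠ 0 := by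
    rw [hA, ENNReal.ofReal_ne_zero_iff]
    exact mul_pos (Real.rpow_pos_of_pos (by linarith) _) (noiseConst_pos hqp)
  refine ⟨A * ENNReal.ofReal (((1 + Real.sqrt ρ) ^ q) ^ p)⁻¹,
    A * ENNReal.ofReal (((1 - Real.sqrt ρ) ^ q) ^ p)⁻¹, mul_ne_zero hA0 ?_,
    ENNReal.mul_ne_top ENNReal.ofReal_ne_top ENNReal.ofReal_ne_top, fun f hf => ?_⟩
  · rw [ENNReal.ofReal_ne_zero_iff]
    positivity
  have hlaw : ∫⁻ ε, f (upperCoords ε) ∂noiseLaw p q hqp ρ =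
      A * ∫⁻ ε, f (upperCoords ε) ∂(muPos q).withDensity (noiseDens p q hqp ρ) := by
    rw [noiseLaw, lintegral_smul_measure, smul_eq_mul]
    rfl
  rw [hlaw, mul_assoc, mul_assoc, ← lintegral_muPos_withDensity (by positivity) hf,
    ← lintegral_muPos_withDensity (by positivity) hf]
  constructor <;> gcongr
  · exact withDensity_mono (.of_forall fun ε => (noiseDens_bounds hqp hρ1 ε).1)
  · exact withDensity_mono (.of_forall fun ε => (noiseDens_bounds hqp hρ1 ε).2)

end MpCN

/-! ### The drift of the Metropolis–Hastings kernel -/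

lemma Matrix.posDef_of_near_half {q : ℕ} {S : Matrix (Fin q) (Fin q) ℝ} (hS : S.IsHermitian)
    (h : ∀ i j, |S i j - (1 / 2 : ℝ) * (1 : Matrix (Fin q) (Fin q) ℝ) i j| ≤ 1 / (4 * (q + 1))) :
    S.PosDef := by
  refine .of_dotProduct_mulVec_pos hS fun x hx => ?_
  obtain ⟨E, hE⟩ : ∃ E, E = S - (1 / 2 : ℝ) • (1 : Matrix (Fin q) (Fin q) ℝ) := ⟨_, rfl⟩
  have hSE : S = (1 / 2 : ℝ) • (1 : Matrix (Fin q) (Fin q) ℝ) + E := by rw [hE]; abel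
  set δ : ℝ := 1 / (4 * (q + 1)) with hδ
  have hδ0 : 0 < δ := by positivity
  have hqδ : δ * q ≤ 1 / 4 := by
    rw [hδ, div_mul_eq_mul_div, div_le_div_iff₀ (by positivity) (by norm_num)]
    linarith
  have hEb : ∀ i j, |E i j| ≤ δ := fun i j => by
    rw [hE]
    exact h i j
  have hxx : 0 < x ⬝ᵥ x := by
    refine lt_of_le_of_ne (Finset.sum_nonneg fun i _ => mul_self_nonneg _) fun h0 => hx ?_
    exact dotProduct_self_eq_zero.1 h0.symm
  have h1 : |x ⬝ᵥ E *ᵥ x| ≤ δ * (∑ i, |x i|) ^ 2 := by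
    calc |x ⬝ᵥ E *ᵥ x| = |∑ i, ∑ j, x i * (E i j * x j)| := by
          simp only [dotProduct, mulVec, Finset.mul_sum]
      _ ≤ ∑ i, ∑ j, |x i * (E i j * x j)| :=
          (Finset.abs_sum_le_sum_abs _ _).trans
            (Finset.sum_le_sum fun i _ => Finset.abs_sum_le_sum_abs _ _)
      _ ≤ ∑ i, ∑ j, δ * (|x i| * |x j|) := by
          refine Finset.sum_le_sum fun i _ => Finset.sum_le_sum fun j _ => ?_
          rw [abs_mul, abs_mul]
          have := mul_le_mul_of_nonneg_right (hEb i j) (mul_nonneg (abs_nonneg (x i))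
            (abs_nonneg (x j)))
          linarith
      _ = _ := by rw [pow_two, Finset.sum_mul_sum, Finset.mul_sum]; simp only [Finset.mul_sum]
  have h2 : (∑ i, |x i|) ^ 2 ≤ q * (x ⬝ᵥ x) := by
    have := sq_sum_le_card_mul_sum_sq (s := Finset.univ) (f := fun i => |x i|)
    simpa [dotProduct, pow_two] using this
  have h3 : δ * (∑ i, |x i|) ^ 2 ≤ 1 / 4 * (x ⬝ᵥ x) := by
    calc _ ≤ δ * (q * (x ⬝ᵥ x)) := by gcongr
      _ = δ * q * (x ⬝ᵥ x) := by ring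
      _ ≤ _ := by gcongr
  rw [star_trivial, hSE, add_mulVec, dotProduct_add, smul_mulVec, one_mulVec, dotProduct_smul,
    smul_eq_mul]
  have := (abs_le.1 h1).1
  linarith

namespace MpCN

lemma symOfUpper_add_smul {q : ℕ} (v : UpperIdx q → ℝ) (t : ℝ) :
    symOfUpper (v + t • upperCoords ⟨1, PosDef.one⟩) = symOfUpper v + t • 1 := by
  have h := symOfUpper_upperCoords (⟨1, PosDef.one⟩ : PosDefMat q)
  ext i j
  have h' := congrFun (congrFun h i) j
  simp only [symOfUpper, of_apply] at h'
  simp [symOfUpper, h']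

/-- A ball of `P⁺(q)` around `I/2`, in upper-triangular coordinates. -/
def halfBall (q : ℕ) : Set (UpperIdx q → ℝ) :=
  Metric.ball ((1 / 2 : ℝ) • upperCoords ⟨1, PosDef.one⟩) (1 / (4 * (q + 1)))

lemma posDef_of_mem_halfBall {q : ℕ} {v : UpperIdx q → ℝ} (hv : v ∈ halfBall q) :
    (symOfUpper v).PosDef ∧ (1 - symOfUpper v).PosDef := by
  have h0 : ∀ i j, |symOfUpper v i j - (1 / 2 : ℝ) * (1 : Matrix (Fin q) (Fin q) ℝ) i j| ≤
      1 / (4 * (q + 1)) := by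
    intro i j
    have h1 := (dist_le_pi_dist v _ ⟨(min i j, max i j), min_le_max⟩).trans
      (Metric.mem_ball.1 hv).le
    have h2 := congrFun (congrFun (symOfUpper_upperCoords (⟨1, PosDef.one⟩ : PosDefMat q)) i) j
    simp only [symOfUpper, of_apply] at h2 ⊢
    rw [Real.dist_eq, Pi.smul_apply, smul_eq_mul, h2] at h1
    exact h1
  refine ⟨posDef_of_near_half (isHermitian_symOfUpper v) h0,
    posDef_of_near_half (isHermitian_one.sub (isHermitian_symOfUpper v)) fun i j => ?_⟩
  rw [← abs_neg]
  convert! h0 i j using 2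
  rw [Matrix.sub_apply]
  ring

lemma noiseLaw_lt_top {p q : ℕ} (hqp : q ≤ p) {ρ : ℝ} (hρ1 : ρ < 1) :
    noiseLaw p q hqp ρ Set.univ < ∞ := by
  obtain ⟨c, C, -, hC, h⟩ := exists_noiseLaw_bounds hqp hρ1
  have h1 := (h 1 measurable_one).2
  simp only [Pi.one_apply, lintegral_one, one_mul] at h1
  refine h1.trans_lt (ENNReal.mul_lt_top hC.lt_top (lt_top_iff_ne_top.2 ?_))
  have : (q : ℝ) ≤ p := by exact_mod_cast hqp
  exact lintegral_betaDens_ne_top q _ _ (by linarith) (by linarith)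

lemma noiseLaw_halfBall_pos {p q : ℕ} (hqp : q ≤ p) {ρ : ℝ} (hρ1 : ρ < 1) :
    0 < noiseLaw p q hqp ρ (upperCoords ⁻¹' halfBall q) := by
  obtain ⟨c, C, hc, -, h⟩ := exists_noiseLaw_bounds hqp hρ1
  have hB : MeasurableSet (halfBall q) := measurableSet_ball
  have h1 := (h ((halfBall q).indicator 1) (measurable_one.indicator hB)).1
  have h2 : ∫⁻ ε, (halfBall q).indicator (1 : (UpperIdx q → ℝ) → ℝ≥0∞) (upperCoords ε)
      ∂noiseLaw p q hqp ρ =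
      noiseLaw p q hqp ρ (upperCoords ⁻¹' halfBall q) := by
    rw [← lintegral_indicator_one ((measurableEmbedding_upperCoords q).measurable hB)]
    rfl
  rw [h2] at h1
  refine lt_of_lt_of_le (ENNReal.mul_pos hc ?_) h1
  have hmf : Measurable fun v =>
      (halfBall q).indicator 1 v * betaDens q (((p : ℝ) - q - 1) / 2) p v :=
    (measurable_one.indicator hB).mul (measurable_betaDens _ _ _)
  rw [← pos_iff_ne_zero, lintegral_pos_iff_support hmf]
  refine lt_of_lt_of_le (Metric.measure_ball_pos volume _ (by positivity))
    (measure_mono (s := halfBall q) fun v hv => ?_)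
  have hp := (posDef_of_mem_halfBall hv).1
  rw [Function.mem_support, Set.indicator_of_mem hv, Pi.one_apply, one_mul, betaDens,
    Set.indicator_of_mem (by exact hp), ENNReal.ofReal_ne_zero_iff]
  have := hp.det_pos
  have := (PosDef.one.add hp).det_pos
  positivity

variable {q : ℕ} {dens : PosDefMat q → ℝ}

lemma densRatio_pos (hpos : ∀ S, 0 < dens S) (S ε : PosDefMat q) : 0 < densRatio dens S ε :=
  div_pos (hpos _) (hpos _)

lemma continuous_densRatio (hcont : Continuous dens) (S : PosDefMat q) :
    Continuous (densRatio dens S) :=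
  (hcont.comp (continuous_circ_left S)).div_const _

instance isCountablyGenerated_trAtTop : (trAtTop q).IsCountablyGenerated := by
  unfold trAtTop
  infer_instance

/-- `P̃V(S)/V(S)` as the contribution of the accepted moves plus the rejection probability. The
truncated subtraction is the one of `metropolisKernel`. -/
lemma kernelApply_mpcnKernel {p : ℕ} (hqp : q ≤ p) (ρ : ℝ) (hpos : ∀ S, 0 < dens S)
    (hcont : Continuous dens) (α : ℝ) (S : PosDefMat q) :
    kernelApply (mpcnKernel p q hqp ρ dens) (fun S' => dens S' ^ (-α)) S =
      ENNReal.ofReal (dens S ^ (-α)) *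
        (∫⁻ ε, ENNReal.ofReal (min 1 (densRatio dens S ε) * densRatio dens S ε ^ (-α))
            ∂noiseLaw p q hqp ρ +
          (1 - ∫⁻ ε, ENNReal.ofReal (min 1 (densRatio dens S ε)) ∂noiseLaw p q hqp ρ)) := by
  have hm : Measurable dens := hcont.measurable
  have hma : Measurable fun y => ENNReal.ofReal (acceptProb dens S y) := by
    unfold acceptProb
    fun_prop
  have hmV : Measurable fun y => ENNReal.ofReal (dens y ^ (-α)) := by fun_prop
  have hmc : Measurable fun ε => circ ε S := (continuous_circ_left S).measurable
  have hr := (continuous_densRatio hcont S).measurable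
  have h1 : ∀ ε, ENNReal.ofReal (acceptProb dens S (circ ε S)) *
      ENNReal.ofReal (dens (circ ε S) ^ (-α)) = ENNReal.ofReal (dens S ^ (-α)) *
        ENNReal.ofReal (min 1 (densRatio dens S ε) * densRatio dens S ε ^ (-α)) := by
    intro ε
    have hS := hpos S
    have hε := densRatio_pos hpos S ε
    have e : dens (circ ε S) = dens S * densRatio dens S ε := by
      rw [densRatio]
      field_simp
    have hacc : acceptProb dens S (circ ε S) = min 1 (densRatio dens S ε) := rfl
    rw [hacc, ← ENNReal.ofReal_mul (by positivity), ← ENNReal.ofReal_mul (by positivity)]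
    congr 1
    rw [e, Real.mul_rpow hS.le hε.le]
    ring
  rw [kernelApply, mpcnKernel, metropolisKernel, lintegral_add_measure,
    lintegral_withDensity_eq_lintegral_mul _ hma hmV, lintegral_smul_measure, smul_eq_mul,
    lintegral_dirac' _ hmV, mpcnProposal, lintegral_map (hma.mul hmV) hmc, lintegral_map hma hmc]
  simp only [Pi.mul_apply, h1]
  rw [lintegral_const_mul _ (by fun_prop)]
  simp only [acceptProb, densRatio]
  ring

/-- The contribution of the accepted moves to `P̃V(S)/V(S)` vanishes at infinity. For `ε - I`
indefinite the ratio `π̃(ε ∘ S)/π̃(S)` need not converge, but `ε + tI < ε + t'I` for `t < t'`, so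
the product of the values of the integrand at two distinct points of a line `ε + ℝI` tends to `0`. -/
lemma tendsto_lintegral_acceptProb_mul {p : ℕ} (hqp : q ≤ p) {ρ : ℝ} (hρ1 : ρ < 1)
    {U : PosDefMat p} (hpos : ∀ S, 0 < dens S) (hcont : Continuous dens)
    (hrapid : RapidlyVaryingPos U dens) {α : ℝ}
    (hα : α ∈ Set.Ioo (0 : ℝ) 1) :
    Tendsto (fun S => ∫⁻ ε, ENNReal.ofReal
      (min 1 (densRatio dens S ε) * densRatio dens S ε ^ (-α)) ∂noiseLaw p q hqp ρ)
      (trAtTop q) (𝓝 0) := by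
  classical
  obtain ⟨c, C, -, hC, hbd⟩ := exists_noiseLaw_bounds hqp hρ1
  set G : PosDefMat q → (UpperIdx q → ℝ) → ℝ≥0∞ := fun S v =>
    if h : (symOfUpper v).PosDef then ENNReal.ofReal
      (min 1 (densRatio dens S ⟨symOfUpper v, h⟩) * densRatio dens S ⟨symOfUpper v, h⟩ ^ (-α))
    else 0 with hG
  have hGm : ∀ S, Measurable (G S) := by
    intro S
    have hr := (continuous_densRatio hcont S).measurable
    have hsub : Measurable fun v : {v : UpperIdx q → ℝ | (symOfUpper v).PosDef} =>
        (⟨symOfUpper v.1, v.2⟩ : PosDefMat q) :=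
      ((continuous_symOfUpper q).measurable.comp measurable_subtype_coe).subtype_mk
    refine Measurable.dite (s := {v | (symOfUpper v).PosDef})
      (f := fun v => ENNReal.ofReal (min 1 (densRatio dens S ⟨symOfUpper v.1, v.2⟩) *
        densRatio dens S ⟨symOfUpper v.1, v.2⟩ ^ (-α))) (g := fun _ => 0)
      ?_ measurable_const (measurableSet_posDef_symOfUpper q)
    have h2 := hr.comp hsub
    exact ((measurable_const.min h2).mul (h2.pow_const _)).ennreal_ofReal
  have hGu : ∀ S ε, G S (upperCoords ε) = ENNReal.ofReal
      (min 1 (densRatio dens S ε) * densRatio dens S ε ^ (-α)) := by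
    intro S ε
    have h1 : (symOfUpper (upperCoords ε)).PosDef := symOfUpper_upperCoords ε ▸ ε.2
    have h2 : (⟨symOfUpper (upperCoords ε), h1⟩ : PosDefMat q) = ε :=
      Subtype.ext (symOfUpper_upperCoords ε)
    simp only [hG, dif_pos h1, h2]
  have hqp' : (q : ℝ) ≤ p := by exact_mod_cast hqp
  have key := tendsto_lintegral_of_pairwise_lines (l := trAtTop q) volume
    (upperCoords (⟨1, PosDef.one⟩ : PosDefMat q)) G (betaDens q (((p : ℝ) - q - 1) / 2) p) hGm
    (fun S v => by
      simp only [hG]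
      split_ifs with h
      · exact ENNReal.ofReal_le_one.2 (min_one_mul_rpow_le (densRatio_pos hpos _ _) hα)
      · exact zero_le_one)
    (measurable_betaDens _ _ _)
    (lintegral_betaDens_ne_top q _ _ (by linarith) (by linarith)) (fun v t t' htt => by
      by_cases h : (symOfUpper (v + t • upperCoords (⟨1, PosDef.one⟩ : PosDefMat q))).PosDef
      swap
      · simp only [hG, dif_neg h, zero_mul]
        exact tendsto_const_nhds
      by_cases h' : (symOfUpper (v + t' • upperCoords (⟨1, PosDef.one⟩ : PosDefMat q))).PosDef
      swap
      · simp only [hG, dif_neg h', mul_zero]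
        exact tendsto_const_nhds
      have hdiff : (symOfUpper (v + t' • upperCoords (⟨1, PosDef.one⟩ : PosDefMat q)) -
          symOfUpper (v + t • upperCoords (⟨1, PosDef.one⟩ : PosDefMat q))).PosDef := by
        rw [symOfUpper_add_smul, symOfUpper_add_smul]
        convert! (PosDef.one (n := Fin q) (R := ℝ)).smul (sub_pos.2 htt) using 1
        module
      have h1 := tendsto_dens_circ_div hqp hrapid (A := ⟨_, h⟩) (B := ⟨_, h'⟩) hdiff
      have hc0 : 0 < min α (1 - α) := lt_min hα.1 (by linarith [hα.2])
      have h2 := ENNReal.tendsto_ofReal (h1.rpow_const (p := min α (1 - α)) (Or.inr hc0.le))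
      rw [Real.zero_rpow hc0.ne', ENNReal.ofReal_zero] at h2
      refine tendsto_of_tendsto_of_tendsto_of_le_of_le tendsto_const_nhds h2
        (fun _ => zero_le) fun S => ?_
      simp only [hG, dif_pos h, dif_pos h']
      have hp1 := densRatio_pos hpos S ⟨_, h⟩
      have hp2 := densRatio_pos hpos S ⟨_, h'⟩
      rw [← ENNReal.ofReal_mul (by positivity)]
      refine ENNReal.ofReal_le_ofReal ((min_one_mul_rpow_mul_le hp1 hp2 hα).trans_eq ?_)
      have hS := hpos S
      rw [densRatio, densRatio, div_div_div_cancel_right₀ hS.ne'])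
  have key2 := ENNReal.Tendsto.const_mul (a := C) key (Or.inr hC)
  rw [mul_zero] at key2
  refine tendsto_of_tendsto_of_tendsto_of_le_of_le tendsto_const_nhds key2
    (fun _ => zero_le) fun S => ?_
  have := (hbd (G S) (hGm S)).2
  simpa only [hGu] using this

/-- Moves with `ε < I` are eventually all accepted, so the acceptance probability is asymptotically
at least the mass of `halfBall`. -/
lemma eventually_lintegral_acceptProb_gt {p : ℕ} (hqp : q ≤ p) {ρ : ℝ} (hρ1 : ρ < 1)
    {U : PosDefMat p} (hpos : ∀ S, 0 < dens S) (hcont : Continuous dens)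
    (hrapid : RapidlyVaryingPos U dens)
    {b : ℝ≥0∞} (hb : b < noiseLaw p q hqp ρ (upperCoords ⁻¹' halfBall q)) :
    ∀ᶠ S in trAtTop q,
      b < ∫⁻ ε, ENNReal.ofReal (min 1 (densRatio dens S ε)) ∂noiseLaw p q hqp ρ := by
  set B : Set (PosDefMat q) := upperCoords ⁻¹' halfBall q with hBdef
  have hB : MeasurableSet B :=
    (measurableEmbedding_upperCoords q).measurable measurableSet_ball
  have key : Tendsto (fun S => ∫⁻ ε in B, ENNReal.ofReal (min 1 (densRatio dens S ε))
      ∂noiseLaw p q hqp ρ) (trAtTop q) (𝓝 (∫⁻ _ in B, 1 ∂noiseLaw p q hqp ρ)) := by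
    refine tendsto_lintegral_filter_of_dominated_convergence (fun _ => 1)
      (.of_forall fun S => ?_) (.of_forall fun S => .of_forall fun ε => ?_) ?_ ?_
    · have hr := (continuous_densRatio hcont S).measurable
      fun_prop
    · exact ENNReal.ofReal_le_one.2 (min_le_left _ _)
    · rw [setLIntegral_one]
      exact ((measure_mono (Set.subset_univ _)).trans_lt (noiseLaw_lt_top hqp hρ1)).ne
    · filter_upwards [ae_restrict_mem hB] with ε hε
      have h1 := (posDef_of_mem_halfBall hε).2
      rw [symOfUpper_upperCoords] at h1
      have h2 := tendsto_dens_circ_div hqp hrapid (A := ε) (B := ⟨1, PosDef.one⟩) h1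
      refine tendsto_const_nhds.congr' ?_
      filter_upwards [h2.eventually_lt_const one_pos] with S hS
      rw [circ_one, div_lt_one (hpos _)] at hS
      rw [min_eq_left, ENNReal.ofReal_one]
      rw [densRatio, le_div_iff₀ (hpos _)]
      linarith
  rw [setLIntegral_one] at key
  filter_upwards [key.eventually_const_lt hb] with S hS
  exact hS.trans_le (setLIntegral_le_lintegral _ _)

end MpCN

lemma EReal.sub_div_le_neg_of_le {P : ℝ≥0∞} {V e : ℝ} (hV : 0 < V) (he : e ≤ 1)
    (h : P ≤ ENNReal.ofReal V * ENNReal.ofReal (1 - e)) :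
    ((P : EReal) - (V : EReal)) / (V : EReal) ≤ ((-e : ℝ) : EReal) := by
  rw [← ENNReal.ofReal_mul hV.le] at h
  have h1 : (P : EReal) ≤ ((V * (1 - e) : ℝ) : EReal) := by
    have h2 : 0 ≤ V * (1 - e) := mul_nonneg hV.le (by linarith)
    calc (P : EReal) ≤ (ENNReal.ofReal (V * (1 - e)) : EReal) := by exact_mod_cast h
      _ = _ := by rw [EReal.coe_ennreal_ofReal, max_eq_left h2]
  calc _ ≤ (((V * (1 - e) : ℝ) : EReal) - (V : EReal)) / (V : EReal) :=
        EReal.div_le_div_right_of_nonneg (by exact_mod_cast hV.le) (EReal.sub_le_sub h1 le_rfl)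
    _ = ((-e : ℝ) : EReal) := by
        rw [← EReal.coe_sub, ← EReal.coe_div]
        congr 1
        field_simp
        ring

theorem mainTheorem8 (p q : ℕ) (hq : 1 ≤ q) (hqp : q ≤ p) (ρ : ℝ) (hρ0 : 0 ≤ ρ) (hρ1 : ρ < 1)
    (U : MpCN.PosDefMat p) (dens : MpCN.PosDefMat q → ℝ)
    (htarget : IsProbabilityMeasure (MpCN.targetMeasure dens))
    (hpos : ∀ S, 0 < dens S) (hcont : Continuous dens)
    (hrapid : MpCN.RapidlyVaryingPos U dens) (α : ℝ) (hα : α ∈ Set.Ioo (0 : ℝ) 1) :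
    limsup (fun S : MpCN.PosDefMat q =>
      ((MpCN.kernelApply (MpCN.mpcnKernel p q hqp ρ dens) (fun S' => dens S' ^ (-α)) S : EReal)
          - ((dens S ^ (-α) : ℝ) : EReal)) / ((dens S ^ (-α) : ℝ) : EReal))
      (MpCN.trAtTop q) < 0 := by
  set m := MpCN.noiseLaw p q hqp ρ (MpCN.upperCoords ⁻¹' MpCN.halfBall q) with hm
  have hm0 : 0 < m := MpCN.noiseLaw_halfBall_pos hqp hρ1
  have hmt : m ≠ ∞ :=
    ((measure_mono (Set.subset_univ _)).trans_lt (MpCN.noiseLaw_lt_top hqp hρ1)).ne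
  have hmr : 0 < m.toReal := ENNReal.toReal_pos hm0.ne' hmt
  obtain ⟨e, he0, he1, hem⟩ : ∃ e : ℝ, 0 < e ∧ e ≤ 1 / 4 ∧ 2 * e < m.toReal :=
    ⟨min (1 / 4) (m.toReal / 4), by positivity, min_le_left _ _, by
      linarith [min_le_right (1 / 4) (m.toReal / 4)]⟩
  have h1 : ENNReal.ofReal (2 * e) < m := (ENNReal.ofReal_lt_iff_lt_toReal (by linarith) hmt).2 hem
  -- Once the accepted moves contribute less than `e` and the acceptance probability exceeds `2e`,
  -- the relative drift is at most `e - 2e = -e`.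
  refine lt_of_le_of_lt (limsup_le_of_le (a := ((-e : ℝ) : EReal)) (h := ?_))
    (by exact_mod_cast neg_lt_zero.2 he0)
  filter_upwards [MpCN.eventually_lintegral_acceptProb_gt hqp hρ1 hpos hcont hrapid h1,
    (MpCN.tendsto_lintegral_acceptProb_mul hqp hρ1 hpos hcont hrapid hα).eventually_lt_const
      (ENNReal.ofReal_pos.2 he0)] with S hrej hacc
  refine EReal.sub_div_le_neg_of_le (Real.rpow_pos_of_pos (hpos S) _) (by linarith) ?_
  rw [MpCN.kernelApply_mpcnKernel hqp ρ hpos hcont]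
  gcongr
  calc _ ≤ ENNReal.ofReal e + (1 - ENNReal.ofReal (2 * e)) := by gcongr
    _ = ENNReal.ofReal (1 - e) := by
      rw [← ENNReal.ofReal_one, ← ENNReal.ofReal_sub _ (by linarith),
        ← ENNReal.ofReal_add he0.le (by linarith)]
      congr 1
      ring
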